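/- A state is a positive trace class operator of trace one, and a quantum channel is a linear, completely positive, trace-preserving map on the trace class operators of a Hilbert space. Let $\Phi$ be a generalised phase-damping channel on $H=L^2(\mathbb R)$, that is, a quantum channel for which there is a Lebesgue measurable function $\lambda:\mathbb R\to\mathbb C$ with $\lambda(0)=1$, $\lambda(-x)=\overline{\lambda(x)}$ for all $x$, and positive definite, i.e. $$\sum_{n,m=1}^N\lambda(x_n-x_m)c_n\overline{c_m}\ge 0\qquad\text{for all } N,\ x_1,\dots,x_N\in\mathbb R,\ c_1,\dots,c_N\in\mathbb C,$$ such that $\Phi(|x\rangle\langle y|)=\lambda(x-y)|x\rangle\langle y|$ in the sense that, for all $\psi,\phi\in L^2(\mathbb R)$ and almost every $x$, $$(\Phi(|\psi\rangle\langle\psi|)\phi)(x)=\int_{\mathbb R}\lambda(x-y)\,\psi(x)\overline{\psi(y)}\,\phi(y)\,dy .$$ Then $\lambda$ is the Fourier transform of a probability measure $\mu$ on $\mathbb R$: $$\lambda(x)=\int_{\mathbb R}e^{ixy}\,d\mu(y)\qquad\text{for all } x\in\mathbb R .$$ Moreover, there is a strongly continuous one-parameter group of unitaries $(U_t)_{t\in\mathbb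 R}$ on $L^2(\mathbb R)$, $U_0=I$, namely $(U_t\psi)(x)=e^{itx}\psi(x)$, such that for every state $\rho$ on $L^2(\mathbb R)$ $$\Phi(\rho)=\int_{\mathbb R}U_t\,\rho\,U_t^*\,d\mu(t),$$ where the integral is a Bochner integral in operator norm. -/

import Mathlib

open MeasureTheory
open scoped ComplexOrder ComplexConjugate

universe u

namespace QuantumDamping

section TraceClassOperators

variable {H : Type u} [NormedAddCommGroup H] [InnerProductSpace ℂ H] [CompleteSpace H]

/-- `T` is a trace class operator: `T = ∑ₙ |xₙ⟩⟨yₙ|` with `∑ₙ ‖xₙ‖ ‖yₙ‖ < ∞`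
(on a Hilbert space the nuclear operators are exactly the trace class operators). -/
def IsTraceClass (T : H →L[ℂ] H) : Prop :=
  ∃ x y : ℕ → H, Summable (fun n => ‖x n‖ * ‖y n‖) ∧
    HasSum (fun n => InnerProductSpace.rankOne ℂ (x n) (y n)) T

theorem isTraceClass_rankOne (x y : H) : IsTraceClass (InnerProductSpace.rankOne ℂ x y) := by
  refine ⟨fun n => if n = 0 then x else 0, fun n => if n = 0 then y else 0, ?_, ?_⟩
  · refine summable_of_ne_finset_zero (s := {0}) ?_
    intro n hn
    simp_all
  · have h := hasSum_ite_eq (0 : ℕ) (InnerProductSpace.rankOne ℂ x y)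
    refine h.congr_fun ?_
    intro n
    by_cases hn : n = 0 <;> simp [hn]

theorem isTraceClass_zero : IsTraceClass (0 : H →L[ℂ] H) := by
  simpa using isTraceClass_rankOne (0 : H) 0

theorem IsTraceClass.smul {T : H →L[ℂ] H} (c : ℂ) (hT : IsTraceClass T) :
    IsTraceClass (c • T) := by
  obtain ⟨x, y, hs, hT⟩ := hT
  refine ⟨fun n => c • x n, y, ?_, ?_⟩
  · simpa [norm_smul, mul_assoc] using hs.mul_left ‖c‖
  · simpa using hT.const_smul c

theorem IsTraceClass.add {S T : H →L[ℂ] H} (hS : IsTraceClass S) (hT : IsTraceClass T) :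
    IsTraceClass (S + T) := by
  obtain ⟨x, y, hs, hS⟩ := hS
  obtain ⟨x', y', hs', hT⟩ := hT
  let e := Equiv.natSumNatEquivNat
  refine ⟨fun n => Sum.elim x x' (e.symm n), fun n => Sum.elim y y' (e.symm n), ?_, ?_⟩
  · refine (e.symm.summable_iff
      (f := fun s : ℕ ⊕ ℕ => ‖Sum.elim x x' s‖ * ‖Sum.elim y y' s‖)).2 ?_
    exact Summable.sum (f := fun s : ℕ ⊕ ℕ => ‖Sum.elim x x' s‖ * ‖Sum.elim y y' s‖) hs hs'
  · refine (e.symm.hasSum_iff (f := fun s : ℕ ⊕ ℕ =>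
      InnerProductSpace.rankOne ℂ (Sum.elim x x' s) (Sum.elim y y' s))).2 ?_
    exact HasSum.sum (f := fun s : ℕ ⊕ ℕ =>
      InnerProductSpace.rankOne ℂ (Sum.elim x x' s) (Sum.elim y y' s)) hS hT

variable (H) in
/-- The space of trace class operators on `H`. -/
def TraceClass : Submodule ℂ (H →L[ℂ] H) where
  carrier := {T | IsTraceClass T}
  add_mem' := IsTraceClass.add
  zero_mem' := isTraceClass_zero
  smul_mem' c _ hT := hT.smul c

/-- `z` is the trace of `T`: `z = ∑ᵢ ⟨bᵢ, T bᵢ⟩` for every orthonormal (Hilbert) basis `b`. -/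
def HasTrace (T : H →L[ℂ] H) (z : ℂ) : Prop :=
  ∀ (ι : Type u) (b : HilbertBasis ι ℂ H), HasSum (fun i => inner ℂ (b i) (T (b i))) z

/-- States (density operators): positive trace class operators of trace one. -/
def IsState (ρ : TraceClass H) : Prop :=
  (ρ : H →L[ℂ] H).IsPositive ∧ HasTrace (ρ : H →L[ℂ] H) 1

/-- The operator on `Hⁿ = ℂⁿ ⊗ H` with operator entries `T i j` is positive. -/
def IsPositiveBlock {n : ℕ} (T : Fin n → Fin n → (H →L[ℂ] H)) : Prop :=
  ∀ v : Fin n → H, 0 ≤ ∑ i, ∑ j, inner ℂ (v i) (T i j (v j))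

variable (H) in
/-- A quantum channel: a linear, completely positive, trace preserving map on the trace class
operators. -/
structure QuantumChannel where
  toFun : TraceClass H →ₗ[ℂ] TraceClass H
  completelyPositive : ∀ (n : ℕ) (T : Fin n → Fin n → TraceClass H),
    IsPositiveBlock (fun i j => (T i j : H →L[ℂ] H)) →
      IsPositiveBlock (fun i j => (toFun (T i j) : H →L[ℂ] H))
  tracePreserving : ∀ (T : TraceClass H) (z : ℂ),
    HasTrace (T : H →L[ℂ] H) z → HasTrace (toFun T : H →L[ℂ] H) z

/-- The operator `|ψ⟩⟨ψ|`, as a trace class operator. -/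
noncomputable def ketBra (ψ : H) : TraceClass H :=
  ⟨InnerProductSpace.rankOne ℂ ψ ψ, isTraceClass_rankOne ψ ψ⟩

/-- A strongly continuous one-parameter group of unitaries. -/
structure IsStronglyContinuousUnitaryGroup (U : ℝ → unitary (H →L[ℂ] H)) : Prop where
  map_zero : U 0 = 1
  map_add : ∀ s t, U (s + t) = U s * U t
  continuous_apply : ∀ ψ : H, Continuous (fun t => (U t : H →L[ℂ] H) ψ)

end TraceClassOperators

/-- The Hilbert space `L²(ℝ)`. -/
abbrev L2R : Type := Lp ℂ 2 (volume : Measure ℝ)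

/-- A positive definite kernel on `ℝ`. -/
def IsPositiveDefiniteKernel (K : ℝ → ℝ → ℂ) : Prop :=
  ∀ (n : ℕ) (x : Fin n → ℝ) (c : Fin n → ℂ),
    0 ≤ ∑ i, ∑ j, K (x i) (x j) * c i * conj (c j)

/-- `Φ` is the generalised dephasing channel `Φ(|x⟩⟨y|) = K(x, y) |x⟩⟨y|`: the kernel `K` is
(Lebesgue) measurable, positive definite and normalised by `K(x, x) = 1`, and `Φ(|ψ⟩⟨ψ|)` is the
integral operator with kernel `K(x, y) ψ(x) conj (ψ(y))`. -/
structure IsGeneralisedDephasing (Φ : QuantumChannel L2R) (K : ℝ → ℝ → ℂ) : Prop where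
  aemeasurable : AEMeasurable (fun p : ℝ × ℝ => K p.1 p.2) volume
  positiveDefinite : IsPositiveDefiniteKernel K
  diag : ∀ x, K x x = 1
  apply_ketBra : ∀ ψ φ : L2R,
    (((Φ.toFun (ketBra ψ) : L2R →L[ℂ] L2R) φ : L2R) : ℝ → ℂ) =ᵐ[volume]
      fun x => ∫ y, K x y * ψ x * conj (ψ y) * φ y

/-- `Φ` is the generalised phase-damping channel `Φ(|x⟩⟨y|) = lam(x - y) |x⟩⟨y|`. -/
structure IsGeneralisedPhaseDamping (Φ : QuantumChannel L2R) (lam : ℝ → ℂ) : Prop where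
  dephasing : IsGeneralisedDephasing Φ (fun x y => lam (x - y))
  hermitian : ∀ x, lam (-x) = conj (lam x)

end QuantumDamping

/-! A measurable positive definite function with value `1` at `0` need not be continuous (the
indicator of `{0}` is an example), so Bochner's theorem does not apply at once; trace preservation
supplies the continuity. Let `T` be the image under `Φ` of the pure state given by the indicator of
`[0, 1)`. On the normalised indicators of cells of length `1 / N`, its diagonal elements are `N`
times the integral of `lam (x - y)` over a square of side `1 / N` for the `N` cells inside `[0, 1)`,
and `0` for the others. Since `T` has trace one and these indicators exhaust `L²(ℝ)` as the mesh
shrinks, the mean of `1 - Re lam` over some small square is below any given `ε`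
(`exists_integral_one_sub_re_le`). The quasi-subadditivity of `1 - Re lam` turns this mean into a
pointwise bound near `0` (`one_sub_re_le_of_integral_le`), and continuity at `0` spreads to all of
`ℝ` by `norm_sub_sq_le`.

For Bochner's theorem, positivity of `Φ` tested on modulated Gaussians shows that `lam` times a
Gaussian has nonnegative Fourier transform (`fourier_mul_gaussian_nonneg`). Such a product is
therefore a characteristic function, and tightness gives a limiting measure `μ` as the Gaussian
flattens (`exists_charFun_eq_of_gaussian_fourier_nonneg`).

On pure states the integral formula is Fubini's theorem (`apply_ketBra_eq_integral`). It passes to a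
state by splitting off finitely many pure terms: the rest is positive of small trace, and both sides
are bounded in operator norm by that trace (`apply_state_eq_integral`). -/

namespace QuantumDamping

/-! ### Trace bounds for positive operators, and the passage from pure states to states. -/

section HilbertSpace

open InnerProductSpace

variable {H : Type u} [NormedAddCommGroup H] [InnerProductSpace ℂ H] [CompleteSpace H]

/-- These two properties are all that is needed of the square root: they turn quadratic forms of `A`
into `‖S x‖ ^ 2` and the trace into `∑ ‖S (b i)‖ ^ 2`. -/
theorem exists_selfAdjoint_sqrt {A : H →L[ℂ] H} (hA : A.IsPositive) :
    ∃ S : H →L[ℂ] H, (∀ x y, inner ℂ (S x) y = inner ℂ x (S y)) ∧ ∀ x, A x = S (S x) := by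
  have h0 : 0 ≤ A := by rwa [ContinuousLinearMap.nonneg_iff_isPositive]
  have hS : (CFC.sqrt A).IsPositive := by
    rw [← ContinuousLinearMap.nonneg_iff_isPositive]; exact CFC.sqrt_nonneg A
  refine ⟨CFC.sqrt A, fun x y => hS.1 x y, fun x => ?_⟩
  conv_lhs => rw [← CFC.sqrt_mul_sqrt_self A h0]
  rfl

theorem hasSum_norm_inner_sq {ι : Type*} (b : HilbertBasis ι ℂ H) (x : H) :
    HasSum (fun i => ‖inner ℂ (b i) x‖ ^ 2) (‖x‖ ^ 2) := by
  have h := b.hasSum_inner_mul_inner x x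
  have h2 := (Complex.hasSum_re h)
  convert h2 using 1
  · funext i
    rw [← inner_conj_symm x (b i), ← Complex.normSq_eq_conj_mul_self, Complex.ofReal_re,
      Complex.normSq_eq_norm_sq]
  · rw [inner_self_eq_norm_sq_to_K]
    norm_cast

theorem hasTrace_ketBra (ψ : H) :
    HasTrace (ketBra ψ : H →L[ℂ] H) ((‖ψ‖ ^ 2 : ℝ) : ℂ) := by
  intro ι b
  refine (Complex.hasSum_ofReal.2 (hasSum_norm_inner_sq b ψ)).congr_fun fun i => ?_
  simp only [ketBra, rankOne_apply, inner_smul_right]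
  rw [← inner_conj_symm ψ (b i), ← Complex.normSq_eq_conj_mul_self, Complex.normSq_eq_norm_sq]

theorem inner_apply_eq_norm_sq {A S : H →L[ℂ] H}
    (hS : ∀ x y, inner ℂ (S x) y = inner ℂ x (S y)) (hA : ∀ x, A x = S (S x)) (x : H) :
    inner ℂ x (A x) = ((‖S x‖ ^ 2 : ℝ) : ℂ) := by
  rw [hA, ← hS, inner_self_eq_norm_sq_to_K]
  norm_cast

theorem hasSum_norm_sqrt_sq {A S : H →L[ℂ] H}
    (hS : ∀ x y, inner ℂ (S x) y = inner ℂ x (S y)) (hA : ∀ x, A x = S (S x)) {z : ℝ}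
    (hz : HasTrace A (z : ℂ)) {ι : Type u}
    (b : HilbertBasis ι ℂ H) : HasSum (fun i => ‖S (b i)‖ ^ 2) z := by
  refine Complex.hasSum_ofReal.1 ?_
  refine (hz ι b).congr_fun fun i => ?_
  rw [inner_apply_eq_norm_sq hS hA]

theorem hasSum_norm_inner_sqrt_sq {S : H →L[ℂ] H}
    (hS : ∀ x y, inner ℂ (S x) y = inner ℂ x (S y)) {ι : Type*} (b : HilbertBasis ι ℂ H) (x : H) :
    HasSum (fun i => ‖inner ℂ (S (b i)) x‖ ^ 2) (‖S x‖ ^ 2) := by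
  simpa only [hS] using hasSum_norm_inner_sq b (S x)

/-- The Hilbert–Schmidt norm of `S = √A` is `√z` and dominates its operator norm; applying `S` twice
gives `z`. -/
theorem norm_le_of_hasTrace {A : H →L[ℂ] H} (hA : A.IsPositive) {z : ℝ}
    (hz : HasTrace A (z : ℂ)) : ‖A‖ ≤ z := by
  obtain ⟨S, hS, hAS⟩ := exists_selfAdjoint_sqrt hA
  obtain ⟨w, b, -⟩ := exists_hilbertBasis ℂ H
  have h1 := hasSum_norm_sqrt_sq hS hAS hz b
  have hz0 : 0 ≤ z := h1.nonneg fun i => by positivity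
  have hb : ∀ x, ‖S x‖ ≤ Real.sqrt z * ‖x‖ := by
    intro x
    have h2 := hasSum_norm_inner_sqrt_sq hS b x
    have h3 : ‖S x‖ ^ 2 ≤ z * ‖x‖ ^ 2 := by
      refine hasSum_le (fun i => ?_) h2 (h1.mul_right (‖x‖ ^ 2))
      rw [← mul_pow]
      gcongr
      exact norm_inner_le_norm _ _
    refine abs_le_of_sq_le_sq' ?_ (by positivity) |>.2
    rwa [mul_pow, Real.sq_sqrt hz0]
  refine A.opNorm_le_bound hz0 fun x => ?_
  rw [hAS]
  calc ‖S (S x)‖ ≤ Real.sqrt z * (Real.sqrt z * ‖x‖) :=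
        (hb _).trans (by gcongr; exact hb x)
    _ = z * ‖x‖ := by rw [← mul_assoc, Real.mul_self_sqrt hz0]

theorem QuantumChannel.isPositive_apply (Φ : QuantumChannel H) {T : TraceClass H}
    (hT : (T : H →L[ℂ] H).IsPositive) : (Φ.toFun T : H →L[ℂ] H).IsPositive := by
  have h := Φ.completelyPositive 1 (fun _ _ => T) (by
    intro v
    simpa using hT.inner_nonneg_right (v 0))
  rw [ContinuousLinearMap.isPositive_iff_complex]
  intro x
  have hx := h (fun _ => x)
  simp only [Finset.univ_unique, Finset.sum_singleton] at hx
  -- Conjugation moves the operator to the first slot of the inner product, where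
  -- `isPositive_iff_complex` expects it.
  have hc := Complex.nonneg_iff.1 (star_nonneg_iff.2 hx)
  rw [← starRingEnd_apply, inner_conj_symm] at hc
  exact ⟨Complex.ext rfl hc.2, hc.1⟩

theorem isPositive_ketBra (ψ : H) : (ketBra ψ : H →L[ℂ] H).IsPositive :=
  isPositive_rankOne_self ψ

/-- Removing finitely many terms of the decomposition `ρ = ∑ᵢ |S bᵢ⟩⟨S bᵢ|`, where `S = √ρ`,
leaves a positive operator. -/
theorem isPositive_sub_sum_ketBra {A S : H →L[ℂ] H} (hS : ∀ x y, inner ℂ (S x) y = inner ℂ x (S y))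
    (hA : ∀ x, A x = S (S x)) (hAp : A.IsPositive) {ι : Type*} (b : HilbertBasis ι ℂ H)
    (s : Finset ι) :
    (A - ∑ i ∈ s, (ketBra (S (b i)) : H →L[ℂ] H)).IsPositive := by
  refine ⟨?_, fun x => ?_⟩
  · have h1 : IsSelfAdjoint (A - ∑ i ∈ s, (ketBra (S (b i)) : H →L[ℂ] H)) :=
      hAp.isSelfAdjoint.sub (isSelfAdjoint_sum _ fun i _ => (isPositive_ketBra _).isSelfAdjoint)
    exact (ContinuousLinearMap.isSelfAdjoint_iff_isSymmetric.1 h1)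
  · have h2 := sum_le_hasSum s (fun i _ => by positivity) (hasSum_norm_inner_sqrt_sq hS b x)
    rw [ContinuousLinearMap.reApplyInnerSelf_apply, inner_re_symm]
    have h3 : inner ℂ x ((A - ∑ i ∈ s, (ketBra (S (b i)) : H →L[ℂ] H)) x) =
        ((‖S x‖ ^ 2 - ∑ i ∈ s, ‖inner ℂ (S (b i)) x‖ ^ 2 : ℝ) : ℂ) := by
      rw [sub_apply, inner_sub_right, inner_apply_eq_norm_sq hS hA,
        Complex.ofReal_sub, Complex.ofReal_sum]
      congr 1
      rw [sum_apply, inner_sum]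
      refine Finset.sum_congr rfl fun i _ => ?_
      simp only [ketBra, rankOne_apply, inner_smul_right]
      rw [← inner_conj_symm x (S (b i)), ← Complex.normSq_eq_norm_sq, Complex.mul_conj]
    rw [h3]
    exact sub_nonneg.2 h2

theorem HasTrace.sub {A B : H →L[ℂ] H} {z w : ℂ} (hA : HasTrace A z) (hB : HasTrace B w) :
    HasTrace (A - B) (z - w) := by
  intro ι b
  simpa [inner_sub_right] using (hA ι b).sub (hB ι b)

theorem HasTrace.sum {ι : Type*} (s : Finset ι) {A : ι → H →L[ℂ] H} {z : ι → ℂ}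
    (h : ∀ i ∈ s, HasTrace (A i) (z i)) : HasTrace (∑ i ∈ s, A i) (∑ i ∈ s, z i) := by
  intro κ b
  simpa [inner_sum, sum_apply] using hasSum_sum fun i hi => h i hi κ b

/-- Conjugation of `ρ` by the unitaries `U t`. -/
noncomputable def unitaryOrbit (U : ℝ → unitary (H →L[ℂ] H)) (A : H →L[ℂ] H) (t : ℝ) :
    H →L[ℂ] H :=
  (U t : H →L[ℂ] H) ∘L A ∘L (star (U t) : H →L[ℂ] H)

variable {U : ℝ → unitary (H →L[ℂ] H)}

theorem norm_unitary_apply (V : unitary (H →L[ℂ] H)) (x : H) : ‖(V : H →L[ℂ] H) x‖ = ‖x‖ :=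
  (Unitary.linearIsometryEquiv V).norm_map x

theorem unitaryOrbit_rankOne (x y : H) (t : ℝ) :
    unitaryOrbit U (rankOne ℂ x y) t =
      rankOne ℂ ((U t : H →L[ℂ] H) x) ((U t : H →L[ℂ] H) y) := by
  ext z
  simp only [unitaryOrbit, ContinuousLinearMap.comp_apply, rankOne_apply, map_smul]
  congr 1
  exact ContinuousLinearMap.adjoint_inner_right _ _ _

theorem norm_unitaryOrbit_le (A : H →L[ℂ] H) (t : ℝ) : ‖unitaryOrbit U A t‖ ≤ ‖A‖ := by
  refine ContinuousLinearMap.opNorm_le_bound _ (norm_nonneg _) fun x => ?_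
  have h : ‖(star (U t) : H →L[ℂ] H) x‖ = ‖x‖ := norm_unitary_apply (star (U t)) x
  calc ‖unitaryOrbit U A t x‖ = ‖A ((star (U t) : H →L[ℂ] H) x)‖ := norm_unitary_apply _ _
    _ ≤ ‖A‖ * ‖x‖ := by rw [← h]; exact A.le_opNorm _

theorem unitaryOrbit_sub (A B : H →L[ℂ] H) (t : ℝ) :
    unitaryOrbit U (A - B) t = unitaryOrbit U A t - unitaryOrbit U B t := by
  ext x; simp [unitaryOrbit]

theorem unitaryOrbit_sum {ι : Type*} (s : Finset ι) (A : ι → H →L[ℂ] H) (t : ℝ) :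
    unitaryOrbit U (∑ i ∈ s, A i) t = ∑ i ∈ s, unitaryOrbit U (A i) t := by
  ext x; simp [unitaryOrbit]

theorem continuous_unitaryOrbit_rankOne (hU : ∀ ψ : H, Continuous fun t => (U t : H →L[ℂ] H) ψ)
    (x y : H) : Continuous (unitaryOrbit U (rankOne ℂ x y)) := by
  have h : unitaryOrbit U (rankOne ℂ x y) = fun t =>
      ContinuousLinearMap.smulRightL ℂ H H (innerSL ℂ ((U t : H →L[ℂ] H) y))
        ((U t : H →L[ℂ] H) x) := by
    funext t
    rw [unitaryOrbit_rankOne]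
    ext z
    simp
  rw [h]
  exact (ContinuousLinearMap.smulRightL ℂ H H).continuous₂.comp
    (((innerSL ℂ (E := H)).continuous.comp (hU y)).prodMk (hU x))

/-- Strong continuity makes orbits of rank one operators norm continuous, and the nuclear series of
`A` converges uniformly in `t`. For a merely bounded `A` norm continuity can fail, so the trace
class hypothesis is what makes a Bochner integral in operator norm available. -/
theorem continuous_unitaryOrbit (hU : ∀ ψ : H, Continuous fun t => (U t : H →L[ℂ] H) ψ)
    {A : H →L[ℂ] H} (hA : IsTraceClass A) : Continuous (unitaryOrbit U A) := by
  obtain ⟨x, y, hs, hA⟩ := hA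
  have h : unitaryOrbit U A = fun t => ∑' n, unitaryOrbit U (rankOne ℂ (x n) (y n)) t := by
    funext t
    refine (HasSum.tsum_eq ?_).symm
    have h1 := ((ContinuousLinearMap.compL ℂ H H H (U t : H →L[ℂ] H)).comp
      ((ContinuousLinearMap.compL ℂ H H H).flip (star (U t) : H →L[ℂ] H))).hasSum hA
    exact h1
  rw [h]
  refine continuous_tsum (fun n => continuous_unitaryOrbit_rankOne hU _ _) hs fun n t => ?_
  exact (norm_unitaryOrbit_le _ _).trans (norm_rankOne _ _).le

theorem integrable_unitaryOrbit (hU : ∀ ψ : H, Continuous fun t => (U t : H →L[ℂ] H) ψ)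
    (μ : Measure ℝ) [IsFiniteMeasure μ] {A : H →L[ℂ] H} (hA : IsTraceClass A) :
    Integrable (unitaryOrbit U A) μ :=
  Integrable.of_bound (continuous_unitaryOrbit hU hA).aestronglyMeasurable ‖A‖
    (Filter.Eventually.of_forall fun _ => norm_unitaryOrbit_le _ _)

/-- A channel which acts on pure states as a mixture of unitary conjugations does so on all
states. -/
theorem QuantumChannel.apply_state_eq_integral (Φ : QuantumChannel H)
    (hU : ∀ ψ : H, Continuous fun t => (U t : H →L[ℂ] H) ψ) (μ : Measure ℝ)
    [IsProbabilityMeasure μ]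
    (hΦ : ∀ ψ : H, (Φ.toFun (ketBra ψ) : H →L[ℂ] H) = ∫ t, unitaryOrbit U (ketBra ψ) t ∂μ)
    {ρ : TraceClass H} (hρ : IsState ρ) :
    (Φ.toFun ρ : H →L[ℂ] H) = ∫ t, unitaryOrbit U ρ t ∂μ := by
  obtain ⟨S, hS, hA⟩ := exists_selfAdjoint_sqrt hρ.1
  obtain ⟨w, b, -⟩ := exists_hilbertBasis ℂ H
  have htr : HasTrace (ρ : H →L[ℂ] H) ((1 : ℝ) : ℂ) := by simpa using hρ.2
  have hsum := hasSum_norm_sqrt_sq hS hA htr b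
  -- The two sides agree on the pure terms removed from `ρ`. Each image of the remainder `σ` has
  -- norm at most the trace of `σ`, hence the factor `2`. No continuity of `Φ` is assumed:
  -- positivity and trace preservation replace it.
  have hbound : ∀ s : Finset w, ‖(Φ.toFun ρ : H →L[ℂ] H) - ∫ t, unitaryOrbit U ρ t ∂μ‖ ≤
      2 * (1 - ∑ i ∈ s, ‖S (b i)‖ ^ 2) := by
    intro s
    set σ : TraceClass H := ρ - ∑ i ∈ s, ketBra (S (b i)) with hσ
    have hσc : (σ : H →L[ℂ] H) =
        (ρ : H →L[ℂ] H) - ∑ i ∈ s, (ketBra (S (b i)) : H →L[ℂ] H) := by simp [hσ]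
    have hσp : (σ : H →L[ℂ] H).IsPositive := by
      rw [hσc]; exact isPositive_sub_sum_ketBra hS hA hρ.1 b s
    have hσt : HasTrace (σ : H →L[ℂ] H) ((1 - ∑ i ∈ s, ‖S (b i)‖ ^ 2 : ℝ) : ℂ) := by
      rw [hσc, Complex.ofReal_sub, Complex.ofReal_sum]
      exact htr.sub (HasTrace.sum s fun i _ => hasTrace_ketBra _)
    have h1 : ‖(σ : H →L[ℂ] H)‖ ≤ 1 - ∑ i ∈ s, ‖S (b i)‖ ^ 2 := norm_le_of_hasTrace hσp hσt
    have h2 : ‖(Φ.toFun σ : H →L[ℂ] H)‖ ≤ 1 - ∑ i ∈ s, ‖S (b i)‖ ^ 2 :=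
      norm_le_of_hasTrace (Φ.isPositive_apply hσp) (Φ.tracePreserving _ _ hσt)
    have h3 : ‖∫ t, unitaryOrbit U σ t ∂μ‖ ≤ 1 - ∑ i ∈ s, ‖S (b i)‖ ^ 2 := by
      refine le_trans ?_ h1
      have := norm_integral_le_of_norm_le_const (μ := μ)
        (Filter.Eventually.of_forall fun t => norm_unitaryOrbit_le (U := U) (σ : H →L[ℂ] H) t)
      simpa using this
    have h4 : (Φ.toFun ρ : H →L[ℂ] H) - ∫ t, unitaryOrbit U ρ t ∂μ =
        (Φ.toFun σ : H →L[ℂ] H) - ∫ t, unitaryOrbit U σ t ∂μ := by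
      have h5 : (Φ.toFun σ : H →L[ℂ] H) = (Φ.toFun ρ : H →L[ℂ] H) -
          ∑ i ∈ s, (Φ.toFun (ketBra (S (b i))) : H →L[ℂ] H) := by
        simp [hσ, map_sub, map_sum]
      have h6 : ∫ t, unitaryOrbit U σ t ∂μ = ∫ t, unitaryOrbit U ρ t ∂μ -
          ∑ i ∈ s, ∫ t, unitaryOrbit U (ketBra (S (b i))) t ∂μ := by
        rw [← integral_finsetSum _ fun i _ => integrable_unitaryOrbit hU μ (ketBra (S (b i))).2,
          ← integral_sub (integrable_unitaryOrbit hU μ ρ.2)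
            (integrable_finsetSum _ fun i _ => integrable_unitaryOrbit hU μ (ketBra (S (b i))).2)]
        simp_rw [hσc, unitaryOrbit_sub, unitaryOrbit_sum]
      rw [h5, h6]
      simp only [hΦ]
      abel
    rw [h4]
    calc _ ≤ _ := norm_sub_le _ _
      _ ≤ _ := by linarith
  have hlim : Filter.Tendsto (fun s : Finset w => 2 * (1 - ∑ i ∈ s, ‖S (b i)‖ ^ 2))
      Filter.atTop (nhds 0) := by
    simpa using (hsum.const_sub 1).const_mul 2
  have h0 : ‖(Φ.toFun ρ : H →L[ℂ] H) - ∫ t, unitaryOrbit U ρ t ∂μ‖ ≤ 0 :=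
    ge_of_tendsto' hlim hbound
  exact sub_eq_zero.1 (norm_le_zero_iff.1 h0)

end HilbertSpace

/-! ### Inequalities for positive definite functions, and continuity from a mean bound. -/

section PositiveDefinite

/-- `lam` is a normalised positive definite function on `ℝ`. -/
structure IsPositiveDefiniteFunction (lam : ℝ → ℂ) : Prop where
  kernel : IsPositiveDefiniteKernel fun x y => lam (x - y)
  map_zero : lam 0 = 1
  map_neg : ∀ x, lam (-x) = conj (lam x)

namespace IsPositiveDefiniteFunction

variable {lam : ℝ → ℂ} (h : IsPositiveDefiniteFunction lam)
include h

/-- With these coefficients the quadratic form equals `1 - ‖lam x‖ ^ 2`. -/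
theorem norm_le_one (x : ℝ) : ‖lam x‖ ≤ 1 := by
  have h1 := (Complex.nonneg_iff.1 (h.kernel 2 ![x, 0] ![1, -lam x])).1
  have h2 : ‖lam x‖ ^ 2 = (lam x).re ^ 2 + (lam x).im ^ 2 := by
    rw [Complex.sq_norm, Complex.normSq_apply]; ring
  simp [Fin.sum_univ_two, h.map_zero, h.map_neg] at h1
  nlinarith [norm_nonneg (lam x)]

theorem re_le_one (x : ℝ) : (lam x).re ≤ 1 :=
  (Complex.re_le_norm _).trans (h.norm_le_one x)

/-- If `lam (x - y)` is read as a Gram matrix of unit vectors `v x`, then `2 * (1 - Re lam (x - y))`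
is a squared distance and this is `‖p + q‖² ≤ 2‖p‖² + 2‖q‖²`. The coefficients `1, -2, 1` express
`‖p - q‖² ≥ 0`. -/
theorem one_sub_re_add_le (x y : ℝ) :
    1 - (lam (x + y)).re ≤ 2 * (1 - (lam x).re) + 2 * (1 - (lam y).re) := by
  have h1 := (Complex.nonneg_iff.1 (h.kernel 3 ![0, y, x + y] ![1, -2, 1])).1
  have h2 : lam (-y + -x) = conj (lam (x + y)) := by rw [← h.map_neg]; ring_nf
  simp [Fin.sum_univ_three, h.map_zero, h.map_neg, h2] at h1
  linarith

/-- Krein's inequality: in the Gram picture it is Cauchy–Schwarz for `v x - v y` against the unit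
vector `v 0`. It reduces continuity everywhere to the behaviour of `Re lam` at `0`. -/
theorem norm_sub_sq_le (x y : ℝ) : ‖lam x - lam y‖ ^ 2 ≤ 2 * (1 - (lam (x - y)).re) := by
  have h1 := (Complex.nonneg_iff.1 (h.kernel 3 ![x, y, 0] ![1, -1, -(lam x - lam y)])).1
  have h2 : lam (y - x) = conj (lam (x - y)) := by rw [← h.map_neg]; ring_nf
  rw [Complex.sq_norm, Complex.normSq_apply]
  simp [Fin.sum_univ_three, h.map_zero, h.map_neg, h2] at h1 ⊢
  linarith

theorem continuous_of_tendsto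
    (h0 : Filter.Tendsto (fun x => (lam x).re) (nhds 0) (nhds 1)) : Continuous lam := by
  rw [continuous_iff_continuousAt]
  intro y
  rw [ContinuousAt, tendsto_iff_norm_sub_tendsto_zero]
  have h1 : Filter.Tendsto (fun x : ℝ => x - y) (nhds y) (nhds 0) := by
    simpa using (continuous_id.sub continuous_const).tendsto y (f := fun x : ℝ => x - y)
  have h2 : Filter.Tendsto (fun x => Real.sqrt (2 * (1 - (lam (x - y)).re)))
      (nhds y) (nhds 0) := by
    have := (((h0.comp h1).const_sub 1).const_mul 2).sqrt
    simpa using this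
  refine squeeze_zero (fun _ => norm_nonneg _) (fun x => ?_) h2
  exact Real.le_sqrt_of_sq_le (h.norm_sub_sq_le x y)

/-- Pointwise bound on `1 - Re lam` near `0` by its mean over a square. -/
theorem one_sub_re_le_of_integral_le {a ε : ℝ} (ha : 0 < a)
    (hm : AEStronglyMeasurable (fun p : ℝ × ℝ => lam (p.1 - p.2)) volume)
    (hi : ∫ p in Set.Ico 0 a ×ˢ Set.Ico 0 a, (1 - (lam (p.1 - p.2)).re) ≤ ε * a ^ 2)
    {s : ℝ} (hs : |s| ≤ a / 2) : 1 - (lam s).re ≤ 8 * ε := by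
  wlog hs0 : 0 ≤ s generalizing s
  · have := this (s := -s) (by rwa [abs_neg]) (by linarith)
    rwa [h.map_neg, Complex.conj_re] at this
  rw [abs_of_nonneg hs0] at hs
  set g : ℝ × ℝ → ℝ := fun p => 1 - (lam (p.1 - p.2)).re with hg
  have hg0 : ∀ p, 0 ≤ g p := fun p => by simpa [hg] using h.re_le_one _
  have hgi : IntegrableOn g (Set.Ico 0 a ×ˢ Set.Ico 0 a) := by
    refine IntegrableOn.of_bound ?_ ?_ 2 ?_
    · rw [Measure.volume_eq_prod, Measure.prod_prod]; simp [ENNReal.mul_lt_top]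
    · have := Complex.continuous_re.comp_aestronglyMeasurable hm
      exact (aestronglyMeasurable_const.sub this).restrict
    · refine Filter.Eventually.of_forall fun p => ?_
      rw [Real.norm_of_nonneg (hg0 p)]
      have := (abs_le.1 ((Complex.abs_re_le_norm _).trans (h.norm_le_one (p.1 - p.2)))).1
      simp only [hg]; linarith
  set Q : Set (ℝ × ℝ) := Set.Ico s a ×ˢ Set.Ico 0 a with hQ
  -- The translation lowers `p.1 - p.2` by `s`, so `s` is the difference of the arguments of `lam`
  -- at `p` and at `τ p`; both points lie in the square of side `a` when `p ∈ Q`.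
  set τ : ℝ × ℝ → ℝ × ℝ := fun p => p + (-s, 0) with hτ
  have hQs : Q ⊆ Set.Ico 0 a ×ˢ Set.Ico 0 a :=
    Set.prod_mono (Set.Ico_subset_Ico_left hs0) le_rfl
  have hτp : MeasurePreserving τ volume volume := measurePreserving_add_right volume _
  have hτe : MeasurableEmbedding τ := (MeasurableEquiv.addRight ((-s, 0) : ℝ × ℝ)).measurableEmbedding
  have hQτ : Q ⊆ τ ⁻¹' (Set.Ico 0 a ×ˢ Set.Ico 0 a) := by
    rintro ⟨x, y⟩ ⟨⟨h1, h2⟩, h3⟩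
    refine ⟨⟨?_, ?_⟩, ?_⟩ <;> simp_all <;> linarith
  have hi2 : ∫ p in τ ⁻¹' (Set.Ico 0 a ×ˢ Set.Ico 0 a), g (τ p) ≤ ε * a ^ 2 := by
    rw [hτp.setIntegral_preimage_emb hτe]; exact hi
  have hgi2 : IntegrableOn (fun p => g (τ p)) (τ ⁻¹' (Set.Ico 0 a ×ˢ Set.Ico 0 a)) :=
    (hτp.integrableOn_comp_preimage hτe).2 hgi
  have hb1 : ∫ p in Q, g p ≤ ε * a ^ 2 :=
    (setIntegral_mono_set hgi (Filter.Eventually.of_forall hg0)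
      (Filter.Eventually.of_forall hQs)).trans hi
  have hb2 : ∫ p in Q, g (τ p) ≤ ε * a ^ 2 :=
    (setIntegral_mono_set hgi2 (Filter.Eventually.of_forall fun p => hg0 _)
      (Filter.Eventually.of_forall hQτ)).trans hi2
  have hvol : volume.real Q = (a - s) * a := by
    rw [hQ, Measure.volume_eq_prod, measureReal_prod_prod]
    rw [Real.volume_real_Ico_of_le (by linarith), Real.volume_real_Ico_of_le ha.le]
    ring
  have hpt : ∀ p : ℝ × ℝ, 1 - (lam s).re ≤ 2 * g p + 2 * g (τ p) := by
    rintro ⟨x, y⟩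
    have h1 := h.one_sub_re_add_le (x - y) (-(x + -s - y))
    rw [h.map_neg, Complex.conj_re] at h1
    have h2 : x - y + -(x + -s - y) = s := by ring
    rw [h2] at h1
    simpa [hg, hτ] using h1
  have hmain : ∫ p in Q, (1 - (lam s).re) ≤ ∫ p in Q, (2 * g p + 2 * g (τ p)) := by
    refine setIntegral_mono ?_ ?_ hpt
    · refine integrableOn_const ?_
      rw [hQ, Measure.volume_eq_prod, Measure.prod_prod]; simp [ENNReal.mul_eq_top]
    · exact ((hgi.mono_set hQs).const_mul 2).add ((hgi2.mono_set hQτ).const_mul 2)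
  rw [integral_add ((hgi.mono_set hQs).const_mul 2) ((hgi2.mono_set hQτ).const_mul 2),
    integral_const_mul, integral_const_mul, setIntegral_const, hvol, smul_eq_mul] at hmain
  have h1 : 0 ≤ 1 - (lam s).re := by simpa using h.re_le_one s
  -- The rectangle `Q` keeps at least half of the square; with the total weight `2 + 2` this
  -- produces the constant `8`.
  have h2 : a / 2 * a ≤ (a - s) * a := by nlinarith
  have h3 : a / 2 * a * (1 - (lam s).re) ≤ 4 * (ε * a ^ 2) := by nlinarith
  have h4 : a ^ 2 * (1 - (lam s).re) ≤ a ^ 2 * (8 * ε) := by nlinarith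
  exact le_of_mul_le_mul_left h4 (by positivity)

end IsPositiveDefiniteFunction

end PositiveDefinite

/-! ### Approximation in `L²(ℝ)` by step functions on uniform grids. -/

section Grid

/-- Best approximation from below: the squared distance from `v` to a vector in the span of a
finite orthonormal family controls the missing mass in Bessel's inequality. -/
theorem norm_sq_sub_le_sum_inner {H ι : Type*} [NormedAddCommGroup H] [InnerProductSpace ℂ H]
    {f : ι → H} (hf : Orthonormal ℂ f) (s : Finset ι) (c : ι → ℂ) (v : H) :
    ‖v‖ ^ 2 - ‖v - ∑ j ∈ s, c j • f j‖ ^ 2 ≤ ∑ j ∈ s, ‖inner ℂ (f j) v‖ ^ 2 := by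
  have h1 : ‖∑ j ∈ s, c j • f j‖ ^ 2 = ∑ j ∈ s, ‖c j‖ ^ 2 := by
    have := hf.inner_sum c c s
    rw [inner_self_eq_norm_sq_to_K] at this
    apply Complex.ofReal_injective
    push_cast
    rw [show ((‖∑ j ∈ s, c j • f j‖ : ℂ)) ^ 2 = _ from this]
    exact Finset.sum_congr rfl fun j _ => Complex.conj_mul' _
  have h2 : RCLike.re (inner ℂ v (∑ j ∈ s, c j • f j)) =
      ∑ j ∈ s, (c j * conj (inner ℂ (f j) v)).re := by
    simp [inner_sum]
  rw [@norm_sub_sq ℂ, h1, h2]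
  have h3 : ∀ j ∈ s, 2 * (c j * conj (inner ℂ (f j) v)).re - ‖c j‖ ^ 2 ≤
      ‖inner ℂ (f j) v‖ ^ 2 := by
    intro j _
    have h4 : 0 ≤ ‖c j - inner ℂ (f j) v‖ ^ 2 := by positivity
    rw [Complex.sq_norm, Complex.normSq_sub, ← Complex.sq_norm, ← Complex.sq_norm] at h4
    linarith
  have h5 := Finset.sum_le_sum h3
  rw [Finset.sum_sub_distrib, ← Finset.mul_sum] at h5
  linarith

/-- The interval `[j / N, (j + 1) / N)`. -/
def gridCell (N : ℕ) (j : ℤ) : Set ℝ := Set.Ico (j / N : ℝ) ((j + 1) / N)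

theorem mem_gridCell_iff {N : ℕ} (hN : 0 < N) {j : ℤ} {x : ℝ} :
    x ∈ gridCell N j ↔ ⌊N * x⌋ = j := by
  have hN' : (0 : ℝ) < N := by exact_mod_cast hN
  rw [gridCell, Set.mem_Ico, Int.floor_eq_iff, div_le_iff₀ hN', lt_div_iff₀ hN', mul_comm x]

theorem measurableSet_gridCell (N : ℕ) (j : ℤ) : MeasurableSet (gridCell N j) :=
  measurableSet_Ico

theorem volume_gridCell_ne_top (N : ℕ) (j : ℤ) : volume (gridCell N j) ≠ ⊤ := by
  simp [gridCell]

theorem volume_real_gridCell (N : ℕ) (j : ℤ) : volume.real (gridCell N j) = 1 / N := by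
  rw [gridCell, Real.volume_real_Ico_of_le (by gcongr; linarith)]
  ring

/-- The normalised indicator functions of the cells of the grid of mesh `1 / N`. -/
noncomputable def gridVec (N : ℕ) (j : ℤ) : L2R :=
  indicatorConstLp 2 (measurableSet_gridCell N j) (volume_gridCell_ne_top N j)
    ((Real.sqrt N : ℝ) : ℂ)

theorem orthonormal_gridVec {N : ℕ} (hN : 0 < N) : Orthonormal ℂ (gridVec N) := by
  have hN' : (0 : ℝ) < N := by exact_mod_cast hN
  refine ⟨fun j => ?_, fun i j hij => ?_⟩
  · rw [gridVec, norm_indicatorConstLp (by norm_num) (by norm_num), volume_real_gridCell,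
      Complex.norm_of_nonneg (Real.sqrt_nonneg _)]
    simp only [ENNReal.toReal_ofNat]
    rw [← Real.sqrt_eq_rpow, ← Real.sqrt_mul hN'.le, mul_one_div_cancel hN'.ne', Real.sqrt_one]
  · have hd : gridCell N i ∩ gridCell N j = ∅ := by
      ext x
      simp only [Set.mem_inter_iff, mem_gridCell_iff hN, Set.mem_empty_iff_false, iff_false]
      rintro ⟨h1, h2⟩
      exact hij (h1.symm.trans h2)
    change inner ℂ (gridVec N i) (gridVec N j) = 0
    unfold gridVec
    rw [L2.inner_indicatorConstLp_indicatorConstLp (measurableSet_gridCell N i)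
      (measurableSet_gridCell N j) (volume_gridCell_ne_top N i) (volume_gridCell_ne_top N j), hd]
    simp

theorem sum_smul_gridVec_ae {N : ℕ} (hN : 0 < N) (s : Finset ℤ) (c : ℤ → ℂ) :
    ((∑ j ∈ s, c j • gridVec N j : L2R) : ℝ → ℂ) =ᵐ[volume] fun x =>
      if ⌊N * x⌋ ∈ s then c ⌊N * x⌋ * (Real.sqrt N : ℝ) else 0 := by
  have h1 : ∀ᵐ x : ℝ, ∀ j : ℤ, gridVec N j x =
      (gridCell N j).indicator (fun _ => ((Real.sqrt N : ℝ) : ℂ)) x :=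
    ae_all_iff.2 fun j => indicatorConstLp_coeFn
  have h2 : ∀ᵐ x : ℝ, ∀ j : ℤ, (c j • gridVec N j : L2R) x = c j * gridVec N j x :=
    ae_all_iff.2 fun j => Lp.coeFn_smul _ _
  filter_upwards [Lp.coeFn_finsetSum s (fun j => c j • gridVec N j), h1, h2] with x hx h1 h2
  rw [hx, Finset.sum_apply]
  have h3 : ∀ j : ℤ, (gridCell N j).indicator (fun _ => ((Real.sqrt N : ℝ) : ℂ)) x =
      if ⌊N * x⌋ = j then ((Real.sqrt N : ℝ) : ℂ) else 0 := by
    intro j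
    by_cases hj : x ∈ gridCell N j
    · rw [Set.indicator_of_mem hj, if_pos ((mem_gridCell_iff hN).1 hj)]
    · rw [Set.indicator_of_notMem hj, if_neg (mt (mem_gridCell_iff hN).2 hj)]
  simp only [h1, h2, h3]
  simp

/-- Replace `v` by a compactly supported continuous `g` and sample `g` at the left ends of the
cells. The `2 * N ^ 2` cells cover `[-N, N)`, so a single parameter both widens the window and
refines the mesh. -/
theorem eventually_exists_norm_sub_gridVec_le (v : L2R) {η : ℝ} (hη : 0 < η) :
    ∀ᶠ N : ℕ in Filter.atTop, ∃ c : ℤ → ℂ,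
      ‖v - ∑ j ∈ Finset.Ico (-(N : ℤ) ^ 2) ((N : ℤ) ^ 2), c j • gridVec N j‖ ≤ η := by
  obtain ⟨g, hgs, hgv, hgc, hgm⟩ := (Lp.memLp v).exists_hasCompactSupport_eLpNorm_sub_le
    (by norm_num) (ε := ENNReal.ofReal (η / 2)) (by simpa using hη)
  have hvg : ‖v - hgm.toLp g‖ ≤ η / 2 := by
    rw [Lp.norm_def]
    refine ENNReal.toReal_le_of_le_ofReal (by positivity) (le_trans (le_of_eq ?_) hgv)
    refine eLpNorm_congr_ae ?_
    filter_upwards [Lp.coeFn_sub v (hgm.toLp g), hgm.coeFn_toLp] with x h1 h2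
    rw [h1, Pi.sub_apply, h2, Pi.sub_apply]
  obtain ⟨R, hR0, hR⟩ : ∃ R : ℝ, 0 < R ∧ ∀ x, R < |x| → g x = 0 := by
    obtain ⟨R, hR⟩ := hgs.isCompact.isBounded.subset_closedBall (0 : ℝ)
    refine ⟨max R 1, by positivity, fun x hx => ?_⟩
    by_contra hne
    have := hR (subset_tsupport g hne)
    rw [mem_closedBall_zero_iff, Real.norm_eq_abs] at this
    exact absurd hx (not_lt.2 (this.trans (le_max_left _ _)))
  -- The constant `κ` on `[-(R + 1), R + 1]` has `L²` norm exactly `η / 2`.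
  set κ : ℝ := η / 2 / Real.sqrt (2 * (R + 1)) with hκ
  have hκ0 : 0 < κ := by positivity
  obtain ⟨δ, hδ, hu⟩ := Metric.uniformContinuous_iff.1
    (hgc.uniformContinuous_of_tendsto_cocompact hgs.is_zero_at_infty) κ hκ0
  filter_upwards [Filter.eventually_gt_atTop ⌈max (R + 1) (1 / δ)⌉₊] with N hN
  have hNR : R + 1 < N := (le_max_left _ _).trans_lt (Nat.lt_of_ceil_lt hN)
  have hNδ : 1 / δ < N := (le_max_right _ _).trans_lt (Nat.lt_of_ceil_lt hN)
  have hN1 : (1 : ℝ) < N := by linarith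
  have hN0 : 0 < N := by exact_mod_cast (zero_lt_one.trans hN1)
  have hN' : (0 : ℝ) < N := by linarith
  refine ⟨fun j => g (j / N) / (Real.sqrt N : ℝ), ?_⟩
  set w : L2R := ∑ j ∈ Finset.Ico (-(N : ℤ) ^ 2) ((N : ℤ) ^ 2),
    (g (j / N) / (Real.sqrt N : ℝ)) • gridVec N j with hw
  have hgw : ‖hgm.toLp g - w‖ ≤ η / 2 := by
    have hfin : volume (Set.Icc (-(R + 1)) (R + 1)) ≠ ⊤ := by simp
    have h1 : ‖hgm.toLp g - w‖ ≤ ‖indicatorConstLp (E := ℂ) 2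
        (measurableSet_Icc (a := -(R + 1)) (b := R + 1)) hfin (κ : ℂ)‖ := by
      refine Lp.norm_le_norm_of_ae_le ?_
      filter_upwards [Lp.coeFn_sub (hgm.toLp g) w, hgm.coeFn_toLp,
        sum_smul_gridVec_ae hN0 (Finset.Ico (-(N : ℤ) ^ 2) ((N : ℤ) ^ 2))
          (fun j => g (j / N) / (Real.sqrt N : ℝ)),
        indicatorConstLp_coeFn (p := 2) (c := (κ : ℂ))
          (hs := measurableSet_Icc (a := -(R + 1)) (b := R + 1)) (hμs := hfin)]
        with x e1 e2 e3 e4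
      rw [e1, Pi.sub_apply, e2, e3, e4]
      have hs0 : ((Real.sqrt N : ℝ) : ℂ) ≠ 0 := by
        exact_mod_cast (Real.sqrt_pos.2 hN').ne'
      rw [div_mul_cancel₀ _ hs0]
      have hk1 : (⌊N * x⌋ : ℝ) ≤ N * x := Int.floor_le _
      have hk2 : N * x < (⌊N * x⌋ : ℝ) + 1 := Int.lt_floor_add_one _
      have hk3 : (⌊N * x⌋ : ℝ) / N ≤ x := by rw [div_le_iff₀ hN']; linarith
      have hk4 : x < (⌊N * x⌋ : ℝ) / N + 1 / N := by
        rw [← add_div, lt_div_iff₀ hN']; linarith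
      have hNi : 1 / (N : ℝ) < 1 := by rw [div_lt_one hN']; exact hN1
      by_cases hx : x ∈ Set.Icc (-(R + 1)) (R + 1)
      · rw [Set.indicator_of_mem hx, if_pos, Complex.norm_of_nonneg hκ0.le, ← dist_eq_norm]
        · refine (hu ?_).le
          rw [Real.dist_eq, abs_of_nonneg (by linarith)]
          have : 1 / (N : ℝ) < δ := by
            rw [div_lt_iff₀ hδ] at hNδ
            rwa [div_lt_iff₀ hN', mul_comm]
          linarith
        · rw [Finset.mem_Ico, Int.le_floor, Int.floor_lt]
          push_cast
          constructor <;> nlinarith [hx.1, hx.2]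
      · rw [Set.indicator_of_notMem hx]
        have hx' : R + 1 < |x| := by
          rw [Set.mem_Icc, ← abs_le] at hx; exact not_le.1 hx
        -- The margin `1` exceeds the mesh, so the sampling point of `x` is also outside the support
        -- of `g`.
        have hk5 : R < |(⌊N * x⌋ : ℝ) / N| := by
          have := abs_sub_abs_le_abs_sub x ((⌊N * x⌋ : ℝ) / N)
          rw [abs_of_nonneg (a := x - (⌊N * x⌋ : ℝ) / N) (by linarith)] at this
          linarith
        rw [hR x (by linarith), hR _ hk5]
        simp
    refine h1.trans (le_of_eq ?_)
    rw [norm_indicatorConstLp (by norm_num) (by norm_num), Complex.norm_of_nonneg hκ0.le,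
      Real.volume_real_Icc_of_le (by linarith)]
    simp only [ENNReal.toReal_ofNat]
    rw [← Real.sqrt_eq_rpow, hκ, show R + 1 - -(R + 1) = 2 * (R + 1) by ring]
    have : Real.sqrt (2 * (R + 1)) ≠ 0 := by positivity
    field_simp
  calc ‖v - w‖ = ‖(v - hgm.toLp g) + (hgm.toLp g - w)‖ := by rw [sub_add_sub_cancel]
    _ ≤ η / 2 + η / 2 := (norm_add_le _ _).trans (add_le_add hvg hgw)
    _ = η := by ring

theorem eventually_norm_sq_sub_le_sum_gridVec (v : L2R) {ε : ℝ} (hε : 0 < ε) :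
    ∀ᶠ N : ℕ in Filter.atTop, ‖v‖ ^ 2 - ε ≤
      ∑ j ∈ Finset.Ico (-(N : ℤ) ^ 2) ((N : ℤ) ^ 2), ‖inner ℂ (gridVec N j) v‖ ^ 2 := by
  filter_upwards [eventually_exists_norm_sub_gridVec_le v (Real.sqrt_pos.2 hε),
    Filter.eventually_gt_atTop 0] with N ⟨c, hc⟩ hN
  refine le_trans ?_ (norm_sq_sub_le_sum_inner (orthonormal_gridVec hN) _ c v)
  have := pow_le_pow_left₀ (norm_nonneg _) hc 2
  rw [Real.sq_sqrt hε.le] at this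
  linarith

end Grid

/-! ### Trace preservation and the mean of `lam` near the diagonal. -/

section TraceMean

/-- Representatives are arbitrary up to null sets, so that explicit indicators and Gaussians can be
substituted. -/
theorem inner_apply_ketBra {Φ : QuantumChannel L2R} {K : ℝ → ℝ → ℂ}
    (hΦ : IsGeneralisedDephasing Φ K) {ψ φ χ : L2R} {p q r : ℝ → ℂ} (hp : ψ =ᵐ[volume] p)
    (hq : φ =ᵐ[volume] q) (hr : χ =ᵐ[volume] r) :
    inner ℂ φ ((Φ.toFun (ketBra ψ) : L2R →L[ℂ] L2R) χ) =
      ∫ x, ∫ y, K x y * p x * conj (p y) * r y * conj (q x) := by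
  rw [L2.inner_def]
  refine integral_congr_ae ?_
  filter_upwards [hΦ.apply_ketBra ψ χ, hp, hq] with x h1 h2 h3
  rw [RCLike.inner_apply, h1, h3, ← integral_mul_const]
  refine integral_congr_ae ?_
  filter_upwards [hp, hr] with y h4 h5
  rw [h2, h4, h5]

/-- The indicator function of `[0, 1)` as a unit vector. -/
noncomputable def unitIntervalVec : L2R :=
  indicatorConstLp 2 (measurableSet_Ico (a := (0 : ℝ)) (b := 1)) (by simp) (1 : ℂ)

theorem norm_unitIntervalVec : ‖unitIntervalVec‖ = 1 := by
  rw [unitIntervalVec, norm_indicatorConstLp (by norm_num) (by norm_num),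
    Real.volume_real_Ico_of_le zero_le_one]
  simp

/-- The end points `0` and `1` are grid points, so each cell lies inside `[0, 1)` or is disjoint
from it. Inside, the two amplitudes `√N` multiply to `N`, and the kernel depends only on `x - y`, so
the square of the cell can be translated to the origin. -/
theorem inner_gridVec_apply_unitIntervalVec {Φ : QuantumChannel L2R} {lam : ℝ → ℂ}
    (hΦ : IsGeneralisedDephasing Φ fun x y => lam (x - y))
    (hi : IntegrableOn (fun p : ℝ × ℝ => lam (p.1 - p.2)) (Set.Ico 0 1 ×ˢ Set.Ico 0 1))
    {N : ℕ} (hN : 0 < N) (j : ℤ) :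
    inner ℂ (gridVec N j) ((Φ.toFun (ketBra unitIntervalVec) : L2R →L[ℂ] L2R) (gridVec N j)) =
      if j ∈ Finset.Ico (0 : ℤ) N then
        N * ∫ p in Set.Ico 0 (1 / N : ℝ) ×ˢ Set.Ico 0 (1 / N : ℝ), lam (p.1 - p.2) else 0 := by
  have hN' : (0 : ℝ) < N := by exact_mod_cast hN
  have hg := indicatorConstLp_coeFn (p := 2) (c := ((Real.sqrt N : ℝ) : ℂ))
    (hs := measurableSet_gridCell N j) (hμs := volume_gridCell_ne_top N j)
  rw [inner_apply_ketBra hΦ (ψ := unitIntervalVec) (φ := gridVec N j)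
    (χ := gridVec N j) indicatorConstLp_coeFn hg hg]
  split_ifs with hj
  · have hj0 : (0 : ℝ) ≤ j := by exact_mod_cast (Finset.mem_Ico.1 hj).1
    have hj1 : (j : ℝ) + 1 ≤ N := by exact_mod_cast (Finset.mem_Ico.1 hj).2
    have hsub : gridCell N j ⊆ Set.Ico 0 1 :=
      Set.Ico_subset_Ico (by positivity) (by rwa [div_le_one hN'])
    have hss : ((Real.sqrt N : ℝ) : ℂ) * ((Real.sqrt N : ℝ) : ℂ) = N := by
      rw [← Complex.ofReal_mul, Real.mul_self_sqrt hN'.le]; simp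
    have h1 : ∀ x y : ℝ, lam (x - y) * (Set.Ico (0 : ℝ) 1).indicator (fun _ => (1 : ℂ)) x *
        conj ((Set.Ico (0 : ℝ) 1).indicator (fun _ => (1 : ℂ)) y) *
        (gridCell N j).indicator (fun _ => ((Real.sqrt N : ℝ) : ℂ)) y *
        conj ((gridCell N j).indicator (fun _ => ((Real.sqrt N : ℝ) : ℂ)) x) =
        (gridCell N j).indicator (fun x => (gridCell N j).indicator
          (fun y => N * lam (x - y)) y) x := by
      intro x y
      by_cases hx : x ∈ gridCell N j
      · by_cases hy : y ∈ gridCell N j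
        · simp only [Set.indicator_of_mem hx, Set.indicator_of_mem hy,
            Set.indicator_of_mem (hsub hx), Set.indicator_of_mem (hsub hy), map_one, mul_one,
            Complex.conj_ofReal]
          rw [mul_assoc, hss, mul_comm]
        · simp [Set.indicator_of_notMem hy]
      · simp [Set.indicator_of_notMem hx]
    have h2 : ∀ x : ℝ, ∫ y, (gridCell N j).indicator (fun x => (gridCell N j).indicator
          (fun y => N * lam (x - y)) y) x =
        (gridCell N j).indicator (fun x => ∫ y in gridCell N j, N * lam (x - y)) x := by
      intro x
      by_cases hx : x ∈ gridCell N j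
      · simp only [Set.indicator_of_mem hx]
        rw [integral_indicator (measurableSet_gridCell N j)]
      · simp [Set.indicator_of_notMem hx]
    simp_rw [h1, h2]
    rw [integral_indicator (measurableSet_gridCell N j)]
    simp_rw [integral_const_mul]
    congr 1
    have hi' : IntegrableOn (fun p : ℝ × ℝ => lam (p.1 - p.2)) (gridCell N j ×ˢ gridCell N j)
        (volume.prod volume) := hi.mono_set (Set.prod_mono hsub hsub)
    rw [← setIntegral_prod (fun p : ℝ × ℝ => lam (p.1 - p.2)) hi', ← Measure.volume_eq_prod]
    set τ : ℝ × ℝ → ℝ × ℝ := fun p => p + ((j / N : ℝ), (j / N : ℝ)) with hτ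
    have hτp : MeasurePreserving τ volume volume := measurePreserving_add_right volume _
    have hτe : MeasurableEmbedding τ :=
      (MeasurableEquiv.addRight (((j / N : ℝ), (j / N : ℝ)) : ℝ × ℝ)).measurableEmbedding
    rw [← hτp.setIntegral_preimage_emb hτe]
    have hpre : τ ⁻¹' (gridCell N j ×ˢ gridCell N j) =
        Set.Ico 0 (1 / N : ℝ) ×ˢ Set.Ico 0 (1 / N : ℝ) := by
      ext ⟨x, y⟩
      simp only [hτ, gridCell, add_div, Set.mem_preimage, Set.mem_prod, Set.mem_Ico, Prod.fst_add,
        Prod.snd_add, le_add_iff_nonneg_left, add_comm (j / N : ℝ) (1 / N), add_lt_add_iff_right]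
    rw [hpre]
    simp [hτ]
  · have h1 : ∀ x y : ℝ, lam (x - y) * (Set.Ico (0 : ℝ) 1).indicator (fun _ => (1 : ℂ)) x *
        conj ((Set.Ico (0 : ℝ) 1).indicator (fun _ => (1 : ℂ)) y) *
        (gridCell N j).indicator (fun _ => ((Real.sqrt N : ℝ) : ℂ)) y *
        conj ((gridCell N j).indicator (fun _ => ((Real.sqrt N : ℝ) : ℂ)) x) = 0 := by
      intro x y
      by_cases hx : x ∈ gridCell N j
      · have hx2 : x ∉ Set.Ico (0 : ℝ) 1 := by
          intro hx3
          refine hj ?_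
          rw [mem_gridCell_iff hN] at hx
          rw [← hx, Finset.mem_Ico, Int.le_floor, Int.floor_lt]
          push_cast
          constructor <;> nlinarith [hx3.1, hx3.2]
        simp [Set.indicator_of_notMem hx2]
      · simp [Set.indicator_of_notMem hx]
    simp [h1]

/-- Trace preservation forces the means of `1 - Re lam` over small squares to be small. -/
theorem exists_integral_one_sub_re_le {Φ : QuantumChannel L2R} {lam : ℝ → ℂ}
    (hΦ : IsGeneralisedDephasing Φ fun x y => lam (x - y))
    (hi : IntegrableOn (fun p : ℝ × ℝ => lam (p.1 - p.2)) (Set.Ico 0 1 ×ˢ Set.Ico 0 1))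
    {ε : ℝ} (hε : 0 < ε) :
    ∃ a : ℝ, 0 < a ∧
      ∫ p in Set.Ico 0 a ×ˢ Set.Ico 0 a, (1 - (lam (p.1 - p.2)).re) ≤ ε * a ^ 2 := by
  set T := Φ.toFun (ketBra unitIntervalVec) with hT
  have hTp : (T : L2R →L[ℂ] L2R).IsPositive := Φ.isPositive_apply (isPositive_ketBra _)
  have hTt : HasTrace (T : L2R →L[ℂ] L2R) ((1 : ℝ) : ℂ) := by
    have := Φ.tracePreserving _ _ (hasTrace_ketBra unitIntervalVec)
    rwa [norm_unitIntervalVec, one_pow] at this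
  obtain ⟨S, hS, hTS⟩ := exists_selfAdjoint_sqrt hTp
  obtain ⟨w, b, -⟩ := exists_hilbertBasis ℂ L2R
  have hsum := hasSum_norm_sqrt_sq hS hTS hTt b
  obtain ⟨F, hF⟩ := (hsum.eventually (lt_mem_nhds (show 1 - ε / 2 < 1 by linarith))).exists
  -- Half of `ε` is spent on truncating the trace to `F`, half on the Bessel defects; the `+ 1`
  -- covers an empty `F`.
  have hε' : 0 < ε / 2 / (F.card + 1) := by positivity
  have hev : ∀ᶠ N : ℕ in Filter.atTop, ∀ i ∈ F, ‖S (b i)‖ ^ 2 - ε / 2 / (F.card + 1) ≤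
      ∑ j ∈ Finset.Ico (-(N : ℤ) ^ 2) ((N : ℤ) ^ 2), ‖inner ℂ (gridVec N j) (S (b i))‖ ^ 2 :=
    (Filter.eventually_all_finset F).2 fun i _ => eventually_norm_sq_sub_le_sum_gridVec _ hε'
  obtain ⟨N, hN, hN0⟩ := (hev.and (Filter.eventually_gt_atTop 0)).exists
  have hN' : (0 : ℝ) < N := by exact_mod_cast hN0
  set J := ∫ p in Set.Ico 0 (1 / N : ℝ) ×ˢ Set.Ico 0 (1 / N : ℝ), lam (p.1 - p.2) with hJ
  have hnorm : ∀ j, ‖S (gridVec N j)‖ ^ 2 = if j ∈ Finset.Ico (0 : ℤ) N then N * J.re else 0 := by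
    intro j
    have h1 := inner_apply_eq_norm_sq hS hTS (gridVec N j)
    rw [hT, inner_gridVec_apply_unitIntervalVec hΦ hi hN0 j] at h1
    have h2 := congrArg Complex.re h1
    rw [Complex.ofReal_re] at h2
    rw [← h2]
    split_ifs <;> simp [hJ]
  -- After exchanging the sums, symmetry of `S` and Parseval in `b` bound the inner sum by `‖S
  -- (gridVec N j)‖ ^ 2`, which vanishes except for the `N` cells in `[0, 1)`.
  have hle : ∑ i ∈ F, (‖S (b i)‖ ^ 2 - ε / 2 / (F.card + 1)) ≤ N * (N * J.re) := by
    calc ∑ i ∈ F, (‖S (b i)‖ ^ 2 - ε / 2 / (F.card + 1)) ≤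
        ∑ i ∈ F, ∑ j ∈ Finset.Ico (-(N : ℤ) ^ 2) ((N : ℤ) ^ 2),
          ‖inner ℂ (gridVec N j) (S (b i))‖ ^ 2 := Finset.sum_le_sum hN
      _ = ∑ j ∈ Finset.Ico (-(N : ℤ) ^ 2) ((N : ℤ) ^ 2), ∑ i ∈ F,
          ‖inner ℂ (gridVec N j) (S (b i))‖ ^ 2 := Finset.sum_comm
      _ ≤ ∑ j ∈ Finset.Ico (-(N : ℤ) ^ 2) ((N : ℤ) ^ 2), ‖S (gridVec N j)‖ ^ 2 := by
          refine Finset.sum_le_sum fun j _ => ?_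
          have := sum_le_hasSum F (fun i _ => by positivity)
            (hasSum_norm_inner_sqrt_sq hS b (gridVec N j))
          simpa only [norm_inner_symm (gridVec N j)] using this
      _ = ∑ j ∈ Finset.Ico (0 : ℤ) N, N * J.re := by
          simp_rw [hnorm]
          rw [← Finset.sum_filter]
          refine Finset.sum_congr ?_ fun _ _ => rfl
          ext j
          simp only [Finset.mem_filter, Finset.mem_Ico]
          have : (N : ℤ) ≤ (N : ℤ) ^ 2 := by nlinarith [hN0]
          constructor
          · rintro ⟨-, h⟩; exact h
          · rintro ⟨h1, h2⟩; exact ⟨⟨by nlinarith, by linarith⟩, h1, h2⟩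
      _ = N * (N * J.re) := by simp
  have hle2 : 1 - ε ≤ N * (N * J.re) := by
    refine le_trans ?_ hle
    rw [Finset.sum_sub_distrib, Finset.sum_const, nsmul_eq_mul]
    have : F.card * (ε / 2 / (F.card + 1)) ≤ ε / 2 := by
      rw [mul_div_assoc', div_le_iff₀ (by positivity)]
      nlinarith
    linarith
  refine ⟨1 / N, by positivity, ?_⟩
  have hsub : Set.Ico 0 (1 / N : ℝ) ⊆ Set.Ico 0 1 :=
    Set.Ico_subset_Ico_right (by rw [div_le_one hN']; exact_mod_cast hN0)
  have hi' := hi.mono_set (Set.prod_mono hsub hsub)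
  have hfin : volume (Set.Ico 0 (1 / N : ℝ) ×ˢ Set.Ico 0 (1 / N : ℝ)) ≠ ⊤ := by
    rw [Measure.volume_eq_prod, Measure.prod_prod]; simp [ENNReal.mul_eq_top]
  have hi1 : IntegrableOn (fun _ : ℝ × ℝ => (1 : ℝ))
      (Set.Ico 0 (1 / N : ℝ) ×ˢ Set.Ico 0 (1 / N : ℝ)) := integrableOn_const hfin
  have hi2 : IntegrableOn (fun p : ℝ × ℝ => (lam (p.1 - p.2)).re)
      (Set.Ico 0 (1 / N : ℝ) ×ˢ Set.Ico 0 (1 / N : ℝ)) := hi'.re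
  rw [integral_sub hi1 hi2, setIntegral_const]
  have hre : ∫ p in Set.Ico 0 (1 / N : ℝ) ×ˢ Set.Ico 0 (1 / N : ℝ), (lam (p.1 - p.2)).re = J.re :=
    integral_re hi'
  rw [hre, Measure.volume_eq_prod, measureReal_prod_prod,
    Real.volume_real_Ico_of_le (by positivity), smul_eq_mul]
  have : J.re = (1 / N) ^ 2 * (N * (N * J.re)) := by field_simp
  rw [this]
  have h2 : (0 : ℝ) < (1 / N) ^ 2 := by positivity
  nlinarith

end TraceMean

/-! ### Bochner's theorem by Gaussian regularisation. -/

section Bochner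

open FourierTransform Filter Topology

theorem integral_norm_fourier_gaussian {c : ℝ} (hc : 0 < c) :
    Integrable (𝓕 fun x : ℝ => Complex.exp (-Real.pi * c * x ^ 2)) ∧
      ∫ t, ‖𝓕 (fun x : ℝ => Complex.exp (-Real.pi * c * x ^ 2)) t‖ = 1 := by
  have hF := fourier_gaussian_pi (b := c) (by simpa using hc)
  rw [hF]
  have hpc : 0 < Real.pi / c := by positivity
  have h1 : ∀ t : ℝ, (1 / (c : ℂ) ^ (1 / 2 : ℂ) * Complex.exp (-Real.pi / c * t ^ 2) : ℂ) =
      ((1 / Real.sqrt c * Real.exp (-(Real.pi / c) * t ^ 2) : ℝ) : ℂ) := by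
    intro t
    rw [Real.sqrt_eq_rpow]
    push_cast
    rw [Complex.ofReal_cpow hc.le]
    push_cast
    ring_nf
  simp_rw [h1]
  refine ⟨((integrable_exp_neg_mul_sq hpc).const_mul _).ofReal, ?_⟩
  have h2 : ∀ t : ℝ, ‖((1 / Real.sqrt c * Real.exp (-(Real.pi / c) * t ^ 2) : ℝ) : ℂ)‖ =
      1 / Real.sqrt c * Real.exp (-(Real.pi / c) * t ^ 2) := fun t =>
    Complex.norm_of_nonneg (by positivity)
  simp_rw [h2]
  rw [integral_const_mul, integral_gaussian, show Real.pi / (Real.pi / c) = c by field_simp]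
  have := (Real.sqrt_pos.2 hc).ne'
  field_simp

/-- The multiplication formula moves the transform onto the Gaussian, where it becomes a density of
mass one. The point is uniformity in `c`. -/
theorem integral_gaussian_mul_fourier_le {f : ℝ → ℂ} (hf : Integrable f) (hb : ∀ x, ‖f x‖ ≤ 1)
    {c : ℝ} (hc : 0 < c) :
    ‖∫ w : ℝ, Complex.exp (-Real.pi * c * w ^ 2) * 𝓕 f w‖ ≤ 1 := by
  have hg : Integrable fun x : ℝ => Complex.exp (-Real.pi * c * x ^ 2) := by
    have := integrable_cexp_neg_mul_sq (b := Real.pi * c) (by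
      rw [← Complex.ofReal_mul, Complex.ofReal_re]; positivity)
    simpa [neg_mul] using this
  have h1 := VectorFourier.integral_fourierIntegral_smul_eq_flip (L := innerₗ ℝ)
    (μ := volume) (ν := volume) Real.continuous_fourierChar continuous_inner hg hf
  have h2 : ∫ w : ℝ, Complex.exp (-Real.pi * c * w ^ 2) * 𝓕 f w =
      ∫ t, 𝓕 (fun x : ℝ => Complex.exp (-Real.pi * c * x ^ 2)) t * f t := by
    simpa using! h1.symm
  rw [h2]
  obtain ⟨hi, h3⟩ := integral_norm_fourier_gaussian hc
  rw [← h3]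
  refine norm_integral_le_of_norm_le hi.norm (Eventually.of_forall fun t => ?_)
  rw [norm_mul]
  exact mul_le_of_le_one_right (norm_nonneg _) (hb t)

theorem continuous_fourier {f : ℝ → ℂ} (hf : Integrable f) : Continuous (𝓕 f) :=
  VectorFourier.fourierIntegral_continuous Real.continuous_fourierChar
    (L := innerₗ ℝ) continuous_inner hf

/-- Nonnegativity turns the uniform bounds on the Gaussian-weighted integrals into integrability, by
Fatou's lemma as `c n → 0`. -/
theorem integrable_fourier_of_nonneg {f : ℝ → ℂ} (hf : Integrable f) (hb : ∀ x, ‖f x‖ ≤ 1)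
    (hpos : ∀ w, 0 ≤ 𝓕 f w) : Integrable (𝓕 f) := by
  have hcont := continuous_fourier hf
  have hre : ∀ w, 𝓕 f w = ((𝓕 f w).re : ℂ) := fun w =>
    Complex.ext rfl (Complex.nonneg_iff.1 (hpos w)).2.symm
  have hnn : ∀ w, 0 ≤ (𝓕 f w).re := fun w => (Complex.nonneg_iff.1 (hpos w)).1
  set c : ℕ → ℝ := fun n => 1 / ((n : ℝ) + 1) with hc
  have hc0 : ∀ n, 0 < c n := fun n => by positivity
  set G : ℕ → ℝ → ℝ := fun n w => Real.exp (-Real.pi * c n * w ^ 2) * (𝓕 f w).re with hG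
  have hGc : ∀ n, Continuous (G n) := fun n =>
    (by fun_prop : Continuous fun w : ℝ => Real.exp (-Real.pi * c n * w ^ 2)).mul
      (Complex.continuous_re.comp hcont)
  have hGi : ∀ n, Integrable (G n) := by
    intro n
    have h1 : Integrable fun w : ℝ => Real.exp (-(Real.pi * c n) * w ^ 2) :=
      integrable_exp_neg_mul_sq (mul_pos Real.pi_pos (hc0 n))
    simp_rw [← neg_mul] at h1
    refine h1.mul_bdd (c := ∫ x, ‖f x‖)
      (Complex.continuous_re.comp hcont).aestronglyMeasurable (Eventually.of_forall fun w => ?_)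
    exact (Complex.abs_re_le_norm _).trans
      (VectorFourier.norm_fourierIntegral_le_integral_norm _ _ _ _ _)
  have hGle : ∀ n, ∫⁻ w, ENNReal.ofReal (G n w) ≤ 1 := by
    intro n
    rw [← ofReal_integral_eq_lintegral_ofReal (hGi n)
      (Eventually.of_forall fun w => mul_nonneg (Real.exp_nonneg _) (hnn w)),
      ← ENNReal.ofReal_one]
    refine ENNReal.ofReal_le_ofReal ?_
    have h1 := integral_gaussian_mul_fourier_le hf hb (hc0 n)
    have h2 : ∫ w : ℝ, Complex.exp (-Real.pi * c n * w ^ 2) * 𝓕 f w = ((∫ w, G n w : ℝ) : ℂ) := by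
      rw [← integral_complex_ofReal]
      refine integral_congr_ae (Eventually.of_forall fun w => ?_)
      simp only [hG]
      rw [hre w]
      push_cast
      simp
    rw [h2, Complex.norm_real] at h1
    exact (le_abs_self _).trans h1
  have hlim : ∀ w, Tendsto (fun n => ENNReal.ofReal (G n w)) atTop
      (𝓝 (ENNReal.ofReal (𝓕 f w).re)) := by
    intro w
    refine ENNReal.tendsto_ofReal ?_
    have h1 : Tendsto c atTop (𝓝 0) := tendsto_one_div_add_atTop_nhds_zero_nat
    have h2 : Tendsto (fun n => Real.exp (-Real.pi * c n * w ^ 2)) atTop (𝓝 1) := by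
      have := (Real.continuous_exp.tendsto _).comp ((h1.const_mul (-Real.pi)).mul_const (w ^ 2))
      simpa [Function.comp_def] using this
    simpa [hG] using h2.mul_const (𝓕 f w).re
  have hfat : ∫⁻ w, ENNReal.ofReal (𝓕 f w).re ≤ 1 := by
    calc ∫⁻ w, ENNReal.ofReal (𝓕 f w).re
        = ∫⁻ w, liminf (fun n => ENNReal.ofReal (G n w)) atTop :=
          lintegral_congr fun w => (hlim w).liminf_eq.symm
      _ ≤ liminf (fun n => ∫⁻ w, ENNReal.ofReal (G n w)) atTop :=
          lintegral_liminf_le fun n => (hGc n).measurable.ennreal_ofReal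
      _ ≤ liminf (fun _ : ℕ => (1 : ENNReal)) atTop :=
          liminf_le_liminf (Eventually.of_forall hGle)
      _ = 1 := liminf_const _
  have hint : Integrable fun w => (𝓕 f w).re := by
    refine ⟨(Complex.continuous_re.comp hcont).aestronglyMeasurable, ?_⟩
    rw [hasFiniteIntegral_iff_ofReal (Eventually.of_forall hnn)]
    exact hfat.trans_lt ENNReal.one_lt_top
  have : 𝓕 f = fun w => ((𝓕 f w).re : ℂ) := funext hre
  rw [this]
  exact hint.ofReal

/-- A continuous integrable function of norm at most `1 = f 0`, with nonnegative Fourier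
transform, is the characteristic function of a probability measure. -/
theorem exists_charFun_eq_of_fourier_nonneg {f : ℝ → ℂ} (hfc : Continuous f) (hf : Integrable f)
    (hb : ∀ x, ‖f x‖ ≤ 1) (h0 : f 0 = 1) (hpos : ∀ w, 0 ≤ 𝓕 f w) :
    ∃ μ : ProbabilityMeasure ℝ, ∀ t, charFun (μ : Measure ℝ) t = f t := by
  have hFi := integrable_fourier_of_nonneg hf hb hpos
  have hre : ∀ w, 𝓕 f w = ((𝓕 f w).re : ℂ) := fun w =>
    Complex.ext rfl (Complex.nonneg_iff.1 (hpos w)).2.symm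
  have hnn : ∀ w, 0 ≤ (𝓕 f w).re := fun w => (Complex.nonneg_iff.1 (hpos w)).1
  have hinv := hfc.fourierInv_fourier_eq hf hFi
  have hmeas : Measurable fun w => (𝓕 f w).re :=
    (Complex.continuous_re.comp (continuous_fourier hf)).measurable
  set ν : Measure ℝ := volume.withDensity fun w => ENNReal.ofReal (𝓕 f w).re with hν
  have hνi : ∀ g : ℝ → ℂ, ∫ w, g w ∂ν = ∫ w, 𝓕 f w * g w := by
    intro g
    rw [hν, integral_withDensity_eq_integral_toReal_smul hmeas.ennreal_ofReal
      (Eventually.of_forall fun w => ENNReal.ofReal_lt_top)]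
    refine integral_congr_ae (Eventually.of_forall fun w => ?_)
    simp only [ENNReal.toReal_ofReal (hnn w)]
    rw [Complex.real_smul, ← hre]
  have hνp : IsProbabilityMeasure ν := by
    refine ⟨?_⟩
    rw [hν, withDensity_apply _ MeasurableSet.univ, Measure.restrict_univ,
      ← ofReal_integral_eq_lintegral_ofReal (f := fun w => (𝓕 f w).re) hFi.re
        (Eventually.of_forall hnn)]
    have h1 := congrFun hinv 0
    rw [Real.fourierInv_eq, h0] at h1
    simp only [inner_zero_right, AddChar.map_zero_eq_one, one_smul] at h1
    have h2 : ∫ w, (𝓕 f w).re = 1 := by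
      rw [show ∫ w, (𝓕 f w).re = _ from integral_re hFi, h1]; simp
    rw [h2, ENNReal.ofReal_one]
  -- The inverse Fourier transform has phase `2πwt` and `charFun` has phase `wt`; the pushforward
  -- absorbs the `2π`.
  have hm : AEMeasurable (fun x : ℝ => 2 * Real.pi * x) ν := by fun_prop
  refine ⟨⟨ν.map (fun x => 2 * Real.pi * x), Measure.isProbabilityMeasure_map hm⟩, fun t => ?_⟩
  change charFun (ν.map (fun x => 2 * Real.pi * x)) t = f t
  rw [charFun_map_mul, charFun_apply_real, hνi]
  conv_rhs => rw [← hinv, Real.fourierInv_eq]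
  refine integral_congr_ae (Eventually.of_forall fun w => ?_)
  simp only [Circle.smul_def, Real.fourierChar_apply, smul_eq_mul]
  rw [mul_comm]
  congr 2
  simp
  ring

/-- Continuity of the limit at `0` gives tightness, and Prokhorov's theorem gives compact closure.
An ultrafilter finer than `atTop` then selects a weak limit, with no need for a subsequence. -/
theorem exists_charFun_eq_of_tendsto {μ : ℕ → ProbabilityMeasure ℝ} {f : ℝ → ℂ}
    (hf : ContinuousAt f 0)
    (h : ∀ t, Tendsto (fun n => charFun (μ n : Measure ℝ) t) atTop (𝓝 (f t))) :
    ∃ ν : ProbabilityMeasure ℝ, ∀ t, charFun (ν : Measure ℝ) t = f t := by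
  have htight : IsTightMeasureSet (Set.range fun n => (μ n : Measure ℝ)) :=
    isTightMeasureSet_of_tendsto_charFun hf h
  have hcomp : IsCompact (closure (Set.range μ)) := by
    refine isCompact_closure_of_isTightMeasureSet ?_
    convert htight
    ext m
    simp
  set V : Ultrafilter ℕ := Ultrafilter.of atTop with hV
  have hVle : (V : Filter ℕ) ≤ atTop := Ultrafilter.of_le atTop
  obtain ⟨ν, -, hν⟩ := hcomp.ultrafilter_le_nhds (V.map μ)
    (le_principal_iff.2 (mem_of_superset 
      (Ultrafilter.mem_map.2 (by rw [Set.preimage_range]; exact Filter.univ_mem))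
      (subset_closure (s := Set.range μ))))
  have hν' : Tendsto μ V (𝓝 ν) := hν
  refine ⟨ν, fun t => ?_⟩
  rw [ProbabilityMeasure.tendsto_iff_forall_integral_rclike_tendsto ℂ] at hν'
  have h1 := hν' (BoundedContinuousFunction.innerProbChar t)
  simp_rw [← charFun_eq_integral_innerProbChar] at h1
  exact tendsto_nhds_unique h1 ((h t).mono_left hVle)

/-- **Bochner's theorem**, for a continuous function whose Gaussian regularisations have
nonnegative Fourier transforms. -/
theorem exists_charFun_eq_of_gaussian_fourier_nonneg {f : ℝ → ℂ} (hfc : Continuous f)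
    (hb : ∀ x, ‖f x‖ ≤ 1) (h0 : f 0 = 1)
    (hpos : ∀ a : ℝ, 0 < a → ∀ w, 0 ≤ 𝓕 (fun x : ℝ => f x * Real.exp (-a * x ^ 2)) w) :
    ∃ μ : ProbabilityMeasure ℝ, ∀ t, charFun (μ : Measure ℝ) t = f t := by
  have hex : ∀ n : ℕ, ∃ μ : ProbabilityMeasure ℝ, ∀ t, charFun (μ : Measure ℝ) t =
      f t * Real.exp (-(1 / ((n : ℝ) + 1)) * t ^ 2) := by
    intro n
    have ha : 0 < 1 / ((n : ℝ) + 1) := by positivity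
    refine exists_charFun_eq_of_fourier_nonneg (by fun_prop) ?_ (fun x => ?_) (by simp [h0])
      (hpos _ ha)
    · exact (integrable_exp_neg_mul_sq ha).ofReal.bdd_mul (c := 1) hfc.aestronglyMeasurable
        (Eventually.of_forall hb)
    · rw [norm_mul, Complex.norm_of_nonneg (Real.exp_nonneg _)]
      refine mul_le_one₀ (hb x) (Real.exp_nonneg _) (Real.exp_le_one_iff.2 ?_)
      rw [neg_mul]
      exact neg_nonpos.2 (by positivity)
  choose μ hμ using hex
  refine exists_charFun_eq_of_tendsto (μ := μ) hfc.continuousAt fun t => ?_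
  simp_rw [hμ]
  have h1 : Tendsto (fun n : ℕ => 1 / ((n : ℝ) + 1)) atTop (𝓝 0) :=
    tendsto_one_div_add_atTop_nhds_zero_nat
  have h2 : Tendsto (fun n : ℕ => Real.exp (-(1 / ((n : ℝ) + 1)) * t ^ 2)) atTop (𝓝 1) := by
    have := (Real.continuous_exp.tendsto _).comp (h1.neg.mul_const (t ^ 2))
    simpa [Function.comp_def] using this
  have h3 : Tendsto (fun n : ℕ => ((Real.exp (-(1 / ((n : ℝ) + 1)) * t ^ 2) : ℝ) : ℂ))
      atTop (𝓝 1) := by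
    simpa [Function.comp_def] using (Complex.continuous_ofReal.tendsto _).comp h2
  simpa using h3.const_mul (f t)

/-- With `u = x - y`, the identity `x² + (x - u)² = 2(x - u/2)² + u²/2` separates the variables. A
quadratic form against a Gaussian thus becomes a single weighted integral of `h`. -/
theorem integral_integral_gaussian_mul {h : ℝ → ℂ} (hc : Continuous h) (hb : ∀ x, ‖h x‖ ≤ 1)
    {a : ℝ} (ha : 0 < a) :
    ∫ x, ∫ y, h (x - y) * Real.exp (-a * (x ^ 2 + y ^ 2)) =
      (∫ v : ℝ, Real.exp (-(2 * a) * v ^ 2) : ℝ) * ∫ u, h u * Real.exp (-(a / 2) * u ^ 2) := by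
  set F : ℝ → ℝ → ℂ := fun x u => h u * Real.exp (-a * (x ^ 2 + (x - u) ^ 2)) with hF
  have h1 : ∀ x, ∫ y, h (x - y) * Real.exp (-a * (x ^ 2 + y ^ 2)) = ∫ u, F x u := by
    intro x
    rw [← integral_sub_left_eq_self (fun y => h (x - y) * Real.exp (-a * (x ^ 2 + y ^ 2))) volume x]
    simp [hF]
  have hint : Integrable (Function.uncurry F) (volume.prod volume) := by
    have hg : Integrable (fun p : ℝ × ℝ =>
        Real.exp (-(a / 2) * p.1 ^ 2) * Real.exp (-(a / 4) * p.2 ^ 2)) (volume.prod volume) :=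
      (integrable_exp_neg_mul_sq (by positivity)).mul_prod
        (integrable_exp_neg_mul_sq (by positivity))
    refine hg.mono' ?_ (Eventually.of_forall fun p => ?_)
    · have : Continuous (Function.uncurry F) := by
        simp only [hF, Function.uncurry_def]
        fun_prop
      exact this.aestronglyMeasurable
    · obtain ⟨x, u⟩ := p
      simp only [hF, Function.uncurry]
      rw [norm_mul, Complex.norm_of_nonneg (Real.exp_nonneg _), ← Real.exp_add]
      refine (mul_le_of_le_one_left (Real.exp_nonneg _) (hb u)).trans (Real.exp_le_exp.2 ?_)
      nlinarith [mul_nonneg ha.le (sq_nonneg (x + (x - u))), mul_nonneg ha.le (sq_nonneg (x - u))]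
  simp_rw [h1]
  rw [integral_integral_swap hint]
  have h2 : ∀ u, ∫ x, F x u = (∫ v : ℝ, Real.exp (-(2 * a) * v ^ 2) : ℝ) *
      (h u * Real.exp (-(a / 2) * u ^ 2)) := by
    intro u
    have h3 : ∀ x, F x u = (Real.exp (-(2 * a) * (x - u / 2) ^ 2) : ℝ) *
        (h u * Real.exp (-(a / 2) * u ^ 2)) := by
      intro x
      simp only [hF]
      rw [show -a * (x ^ 2 + (x - u) ^ 2) = -(2 * a) * (x - u / 2) ^ 2 + -(a / 2) * u ^ 2 by ring,
        Real.exp_add]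
      push_cast
      ring
    simp_rw [h3]
    rw [integral_mul_const, integral_complex_ofReal,
      integral_sub_right_eq_self (fun v : ℝ => Real.exp (-(2 * a) * v ^ 2)) (u / 2)]
  simp_rw [h2]
  rw [integral_const_mul]

end Bochner

/-! ### The modulation group on `L²(ℝ)`. -/

section Modulation

theorem norm_exp_I_mul_mul (t x : ℝ) : ‖Complex.exp (Complex.I * t * x)‖ = 1 := by
  rw [show Complex.I * t * x = ((t * x : ℝ) : ℂ) * Complex.I by push_cast; ring]
  exact Complex.norm_exp_ofReal_mul_I _

theorem memLp_modulation (t : ℝ) (ψ : L2R) :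
    MemLp (fun x : ℝ => Complex.exp (Complex.I * t * x) * ψ x) 2 volume := by
  refine (Lp.memLp ψ).of_le ?_ (Filter.Eventually.of_forall fun x => ?_)
  · exact (by fun_prop : Continuous fun x : ℝ => Complex.exp (Complex.I * t * x)).aestronglyMeasurable.mul
      (Lp.aestronglyMeasurable ψ)
  · rw [norm_mul, norm_exp_I_mul_mul, one_mul]

/-- Multiplication by `x ↦ exp (i t x)`, as a linear isometry of `L²(ℝ)`. -/
noncomputable def modulationIsometry (t : ℝ) : L2R →ₗᵢ[ℂ] L2R where
  toFun ψ := (memLp_modulation t ψ).toLp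
  map_add' ψ φ := by
    apply Lp.ext
    filter_upwards [(memLp_modulation t (ψ + φ)).coeFn_toLp, (memLp_modulation t ψ).coeFn_toLp,
      (memLp_modulation t φ).coeFn_toLp, Lp.coeFn_add ψ φ,
      Lp.coeFn_add (memLp_modulation t ψ).toLp (memLp_modulation t φ).toLp] with x h1 h2 h3 h4 h5
    rw [h1, h5, Pi.add_apply, h2, h3, h4, Pi.add_apply, mul_add]
  map_smul' c ψ := by
    apply Lp.ext
    filter_upwards [(memLp_modulation t (c • ψ)).coeFn_toLp, (memLp_modulation t ψ).coeFn_toLp,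
      Lp.coeFn_smul c ψ, Lp.coeFn_smul c (memLp_modulation t ψ).toLp] with x h1 h2 h3 h4
    rw [h1, RingHom.id_apply, h4, Pi.smul_apply, h2, h3, Pi.smul_apply, smul_eq_mul, smul_eq_mul]
    ring
  norm_map' ψ := by
    change ‖(memLp_modulation t ψ).toLp‖ = ‖ψ‖
    rw [Lp.norm_toLp, Lp.norm_def]
    congr 1
    refine eLpNorm_congr_norm_ae (Filter.Eventually.of_forall fun x => ?_)
    rw [norm_mul, norm_exp_I_mul_mul, one_mul]

theorem modulationIsometry_ae (t : ℝ) (ψ : L2R) :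
    (modulationIsometry t ψ : ℝ → ℂ) =ᵐ[volume] fun x => Complex.exp (Complex.I * t * x) * ψ x :=
  (memLp_modulation t ψ).coeFn_toLp

theorem modulationIsometry_add (s t : ℝ) (ψ : L2R) :
    modulationIsometry (s + t) ψ = modulationIsometry s (modulationIsometry t ψ) := by
  apply Lp.ext
  filter_upwards [modulationIsometry_ae (s + t) ψ, modulationIsometry_ae t ψ,
    modulationIsometry_ae s (modulationIsometry t ψ)] with x h1 h2 h3
  rw [h1, h3, h2, ← mul_assoc, ← Complex.exp_add]
  push_cast
  ring_nf

theorem modulationIsometry_zero (ψ : L2R) : modulationIsometry 0 ψ = ψ := by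
  apply Lp.ext
  filter_upwards [modulationIsometry_ae 0 ψ] with x h1
  rw [h1]
  simp

/-- The unitary group `(U t ψ)(x) = exp (i t x) ψ(x)`. -/
noncomputable def modulation (t : ℝ) : unitary (L2R →L[ℂ] L2R) :=
  Unitary.linearIsometryEquiv.symm
    { (modulationIsometry t) with
      invFun := modulationIsometry (-t)
      left_inv := fun ψ => by
        change modulationIsometry (-t) (modulationIsometry t ψ) = ψ
        rw [← modulationIsometry_add, neg_add_cancel, modulationIsometry_zero]
      right_inv := fun ψ => by
        change modulationIsometry t (modulationIsometry (-t) ψ) = ψ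
        rw [← modulationIsometry_add, add_neg_cancel, modulationIsometry_zero] }

theorem modulation_ae (t : ℝ) (ψ : L2R) :
    (((modulation t : L2R →L[ℂ] L2R) ψ : L2R) : ℝ → ℂ) =ᵐ[volume]
      fun x => Complex.exp (Complex.I * t * x) * ψ x :=
  modulationIsometry_ae t ψ

theorem inner_modulation_right (t : ℝ) (φ ψ : L2R) :
    inner ℂ φ ((modulation t : L2R →L[ℂ] L2R) ψ) =
      ∫ x : ℝ, Complex.exp (Complex.I * t * x) * (ψ x * conj (φ x)) := by
  rw [L2.inner_def]
  refine integral_congr_ae ?_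
  filter_upwards [modulation_ae t ψ] with x h1
  rw [RCLike.inner_apply, h1, mul_assoc]

theorem inner_modulation_left (t : ℝ) (φ ψ : L2R) :
    inner ℂ ((modulation t : L2R →L[ℂ] L2R) ψ) φ =
      ∫ x : ℝ, Complex.exp (-(Complex.I * t * x)) * (φ x * conj (ψ x)) := by
  rw [L2.inner_def]
  refine integral_congr_ae ?_
  filter_upwards [modulation_ae t ψ] with x h1
  rw [RCLike.inner_apply, h1, map_mul, ← Complex.exp_conj]
  simp only [map_mul, Complex.conj_I, Complex.conj_ofReal, neg_mul]
  ring

theorem integrable_mul_conj (ψ φ : L2R) : Integrable fun x => ψ x * conj (φ x) := by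
  simpa only [RCLike.inner_apply] using L2.integrable_inner (𝕜 := ℂ) φ ψ

/-- Dominated convergence gives continuity of the inner product with `χ`; since norms are preserved,
expanding `‖U t ψ - χ‖ ^ 2` upgrades this to norm continuity. -/
theorem continuous_modulation_apply (ψ : L2R) :
    Continuous fun t => (modulation t : L2R →L[ℂ] L2R) ψ := by
  rw [continuous_iff_continuousAt]
  intro s
  rw [ContinuousAt, tendsto_iff_norm_sub_tendsto_zero]
  set χ := (modulation s : L2R →L[ℂ] L2R) ψ with hχ
  have hc : Continuous fun t => inner ℂ χ ((modulation t : L2R →L[ℂ] L2R) ψ) := by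
    simp_rw [inner_modulation_right]
    refine continuous_of_dominated (bound := fun x : ℝ => ‖ψ x * conj (χ x)‖) (fun t => ?_)
      (fun t => Filter.Eventually.of_forall fun x => ?_) (integrable_mul_conj ψ χ).norm
      (Filter.Eventually.of_forall fun x => by fun_prop)
    · exact (by fun_prop : Continuous fun x : ℝ => Complex.exp (Complex.I * t * x)).aestronglyMeasurable.mul
        (integrable_mul_conj ψ χ).1
    · rw [norm_mul, norm_exp_I_mul_mul, one_mul]
  have hsq : ∀ t, ‖(modulation t : L2R →L[ℂ] L2R) ψ - χ‖ =
      Real.sqrt (2 * ‖ψ‖ ^ 2 - 2 * (inner ℂ χ ((modulation t : L2R →L[ℂ] L2R) ψ)).re) := by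
    intro t
    rw [← Real.sqrt_sq (norm_nonneg ((modulation t : L2R →L[ℂ] L2R) ψ - χ)),
      norm_sub_rev, @norm_sub_sq ℂ, norm_unitary_apply, hχ, norm_unitary_apply]
    congr 1
    change ‖ψ‖ ^ 2 - 2 * (inner ℂ _ _ : ℂ).re + _ = _
    ring
  simp_rw [hsq]
  have h1 := ((continuous_const (y := 2 * ‖ψ‖ ^ 2)).sub
    ((Complex.continuous_re.comp hc).const_mul 2)).sqrt.tendsto s
  have h2 : (inner ℂ χ ((modulation s : L2R →L[ℂ] L2R) ψ)).re = ‖ψ‖ ^ 2 := by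
    rw [← hχ, ← norm_unitary_apply (modulation s) ψ, ← hχ]
    exact inner_self_eq_norm_sq (𝕜 := ℂ) χ
  simpa [h2] using h1

theorem isStronglyContinuousUnitaryGroup_modulation :
    IsStronglyContinuousUnitaryGroup modulation where
  map_zero := by
    apply Subtype.ext
    ext1 ψ
    exact modulationIsometry_zero ψ
  map_add s t := by
    apply Subtype.ext
    ext1 ψ
    exact modulationIsometry_add s t ψ
  continuous_apply := continuous_modulation_apply

end Modulation

/-! ### Continuity, positivity and the mixture formula for phase damping. -/

section PhaseDamping

/-- Between `φ` and `χ`, the orbit of `|ψ⟩⟨ψ|` factors as `⟨φ, U t ψ⟩⟨U t ψ, χ⟩`, a double integral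
with phase `exp (i (x - y) t)`. Integrating first in `t` leaves `lam (x - y)`. -/
theorem IsGeneralisedDephasing.apply_ketBra_eq_integral {Φ : QuantumChannel L2R} {lam : ℝ → ℂ}
    (hΦ : IsGeneralisedDephasing Φ fun x y => lam (x - y)) (hc : Continuous lam)
    (hb : ∀ x, ‖lam x‖ ≤ 1) (μ : Measure ℝ) [IsProbabilityMeasure μ]
    (hμ : ∀ x : ℝ, lam x = ∫ t : ℝ, Complex.exp (Complex.I * x * t) ∂μ) (ψ : L2R) :
    (Φ.toFun (ketBra ψ) : L2R →L[ℂ] L2R) =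
      ∫ t, unitaryOrbit modulation (ketBra ψ : L2R →L[ℂ] L2R) t ∂μ := by
  have hint := integrable_unitaryOrbit (U := modulation) continuous_modulation_apply μ (ketBra ψ).2
  ext1 χ
  refine ext_inner_left ℂ fun φ => ?_
  rw [inner_apply_ketBra hΦ (ψ := ψ) (φ := φ) (χ := χ) .rfl .rfl .rfl,
    ContinuousLinearMap.integral_apply hint, ← integral_inner (hint.apply_continuousLinearMap χ)]
  set P : ℝ → ℂ := fun x => ψ x * conj (φ x) with hP
  set Q : ℝ → ℂ := fun y => χ y * conj (ψ y) with hQ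
  have hPQ : Integrable (fun p : ℝ × ℝ => P p.1 * Q p.2) (volume.prod volume) :=
    (integrable_mul_conj ψ φ).mul_prod (integrable_mul_conj χ ψ)
  have hR : ∀ t, inner ℂ φ (unitaryOrbit modulation (ketBra ψ : L2R →L[ℂ] L2R) t χ) =
      ∫ p : ℝ × ℝ, Complex.exp (Complex.I * (p.1 - p.2) * t) * (P p.1 * Q p.2)
        ∂(volume.prod volume) := by
    intro t
    rw [ketBra, unitaryOrbit_rankOne, InnerProductSpace.rankOne_apply, inner_smul_right,
      inner_modulation_left, inner_modulation_right, mul_comm, ← integral_prod_mul]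
    refine integral_congr_ae (Filter.Eventually.of_forall fun p => ?_)
    simp only [hP, hQ]
    rw [show Complex.I * (p.1 - p.2) * t = Complex.I * t * p.1 + -(Complex.I * t * p.2) by ring,
      Complex.exp_add]
    ring
  simp_rw [hR]
  have hL : ∫ x, ∫ y, lam (x - y) * ψ x * conj (ψ y) * χ y * conj (φ x) =
      ∫ p : ℝ × ℝ, lam (p.1 - p.2) * (P p.1 * Q p.2) ∂(volume.prod volume) := by
    rw [integral_prod]
    · refine integral_congr_ae (Filter.Eventually.of_forall fun x =>
        integral_congr_ae (Filter.Eventually.of_forall fun y => ?_))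
      simp only [hP, hQ]
      ring
    · exact hPQ.bdd_mul (c := 1) (by fun_prop : Continuous fun p : ℝ × ℝ =>
        lam (p.1 - p.2)).aestronglyMeasurable (Filter.Eventually.of_forall fun p => hb _)
  rw [hL, integral_integral_swap]
  · refine integral_congr_ae (Filter.Eventually.of_forall fun p => ?_)
    simp only
    rw [hμ, ← integral_mul_const]
    push_cast
    rfl
  · have h1 : Integrable (fun q : ℝ × ℝ × ℝ => (P q.2.1 * Q q.2.2))
        (μ.prod (volume.prod volume)) := hPQ.comp_snd μ
    refine h1.bdd_mul (c := 1) (by fun_prop : Continuous fun q : ℝ × ℝ × ℝ =>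
      Complex.exp (Complex.I * (q.2.1 - q.2.2) * q.1)).aestronglyMeasurable
      (Filter.Eventually.of_forall fun q => ?_)
    rw [← Complex.ofReal_sub, norm_exp_I_mul_mul]

theorem IsGeneralisedPhaseDamping.isPositiveDefiniteFunction {Φ : QuantumChannel L2R}
    {lam : ℝ → ℂ} (hΦ : IsGeneralisedPhaseDamping Φ lam) : IsPositiveDefiniteFunction lam where
  kernel := hΦ.dephasing.positiveDefinite
  map_zero := by simpa using hΦ.dephasing.diag 0
  map_neg := hΦ.hermitian

theorem IsGeneralisedPhaseDamping.continuous {Φ : QuantumChannel L2R}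
    {lam : ℝ → ℂ} (hΦ : IsGeneralisedPhaseDamping Φ lam) : Continuous lam := by
  have hpd := hΦ.isPositiveDefiniteFunction
  have hm : AEStronglyMeasurable (fun p : ℝ × ℝ => lam (p.1 - p.2)) volume :=
    hΦ.dephasing.aemeasurable.aestronglyMeasurable
  have hi : IntegrableOn (fun p : ℝ × ℝ => lam (p.1 - p.2)) (Set.Ico 0 1 ×ˢ Set.Ico 0 1) := by
    refine IntegrableOn.of_bound ?_ hm.restrict 1
      (Filter.Eventually.of_forall fun p => hpd.norm_le_one _)
    rw [Measure.volume_eq_prod, Measure.prod_prod]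
    simp
  refine hpd.continuous_of_tendsto (Metric.tendsto_nhds.2 fun η hη => ?_)
  -- The factor `8` of the pointwise bound turns `η / 16` into `η / 2 < η`.
  obtain ⟨a, ha, hle⟩ := exists_integral_one_sub_re_le hΦ.dephasing hi (ε := η / 16) (by positivity)
  filter_upwards [Metric.closedBall_mem_nhds (0 : ℝ) (half_pos ha)] with s hs
  rw [mem_closedBall_zero_iff, Real.norm_eq_abs] at hs
  have h1 := hpd.one_sub_re_le_of_integral_le ha hm hle hs
  rw [dist_comm, Real.dist_eq, abs_of_nonneg (sub_nonneg.2 (hpd.re_le_one s))]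
  linarith

theorem memLp_two_gaussian_mul_exp {a : ℝ} (ha : 0 < a) (w : ℝ) :
    MemLp (fun x : ℝ => (Real.exp (-a * x ^ 2) : ℂ) * Complex.exp (Complex.I * w * x)) 2
      volume := by
  have hc : Continuous fun x : ℝ =>
    (Real.exp (-a * x ^ 2) : ℂ) * Complex.exp (Complex.I * w * x) := by fun_prop
  rw [memLp_two_iff_integrable_sq_norm hc.aestronglyMeasurable]
  refine (integrable_exp_neg_mul_sq (b := 2 * a) (by positivity)).congr
    (Filter.Eventually.of_forall fun x => ?_)
  simp only
  rw [norm_mul, norm_exp_I_mul_mul, mul_one, Complex.norm_of_nonneg (Real.exp_nonneg _),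
    ← Real.exp_nat_mul]
  congr 1
  push_cast
  ring

open FourierTransform in
-- The transform at `w` is, up to a positive Gaussian constant, `⟨φ, Φ(|ψ⟩⟨ψ|) φ⟩` with `ψ` a
-- Gaussian and `φ` the same Gaussian at frequency `2πw`. Positivity of the channel thus does the
-- work of an integrated form of positive definiteness.
theorem IsGeneralisedDephasing.fourier_mul_gaussian_nonneg {Φ : QuantumChannel L2R} {lam : ℝ → ℂ}
    (hΦ : IsGeneralisedDephasing Φ fun x y => lam (x - y)) (hc : Continuous lam)
    (hb : ∀ x, ‖lam x‖ ≤ 1) {a : ℝ} (ha : 0 < a) (w : ℝ) :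
    0 ≤ 𝓕 (fun x : ℝ => lam x * Real.exp (-a * x ^ 2)) w := by
  set ψ : L2R := (memLp_two_gaussian_mul_exp ha 0).toLp with hψ
  set φ : L2R := (memLp_two_gaussian_mul_exp ha (2 * Real.pi * w)).toLp with hφ
  have hpos := (Φ.isPositive_apply (isPositive_ketBra ψ)).inner_nonneg_right φ
  rw [inner_apply_ketBra hΦ (MemLp.coeFn_toLp _) (MemLp.coeFn_toLp _) (MemLp.coeFn_toLp _)]
    at hpos
  set h : ℝ → ℂ := fun u => lam u * Complex.exp (Complex.I * (-(2 * Real.pi * w) : ℝ) * u) with hh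
  have hhb : ∀ u, ‖h u‖ ≤ 1 := fun u => by
    simp only [hh]
    rw [norm_mul, norm_exp_I_mul_mul, mul_one]
    exact hb u
  have hhc : Continuous h := by fun_prop
  -- Each variable carries one Gaussian from `ψ` and one from `φ`, hence `2 * a`; the change of
  -- variables halves it back to `a`.
  have h1 := integral_integral_gaussian_mul hhc hhb (a := 2 * a) (by positivity)
  have h2 : 𝓕 (fun x : ℝ => lam x * Real.exp (-a * x ^ 2)) w =
      ∫ u, h u * Real.exp (-(2 * a / 2) * u ^ 2) := by
    rw [Real.fourier_eq']
    refine integral_congr_ae (Filter.Eventually.of_forall fun u => ?_)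
    simp only [hh, smul_eq_mul]
    rw [mul_div_cancel_left₀ a two_ne_zero, mul_comm, mul_right_comm]
    congr 3
    simp
    ring
  have h3 : ∫ x : ℝ, ∫ y : ℝ, h (x - y) * Real.exp (-(2 * a) * (x ^ 2 + y ^ 2)) =
      ∫ x : ℝ, ∫ y : ℝ, lam (x - y) *
        ((Real.exp (-a * x ^ 2) : ℂ) * Complex.exp (Complex.I * (0 : ℝ) * x)) *
        conj ((Real.exp (-a * y ^ 2) : ℂ) * Complex.exp (Complex.I * (0 : ℝ) * y)) *
        ((Real.exp (-a * y ^ 2) : ℂ) * Complex.exp (Complex.I * (2 * Real.pi * w : ℝ) * y)) *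
        conj ((Real.exp (-a * x ^ 2) : ℂ) * Complex.exp (Complex.I * (2 * Real.pi * w : ℝ) * x)) := by
    refine integral_congr_ae (Filter.Eventually.of_forall fun x =>
      integral_congr_ae (Filter.Eventually.of_forall fun y => ?_))
    simp only [hh, map_mul, Complex.conj_ofReal, ← Complex.exp_conj, Complex.conj_I]
    simp only [Complex.ofReal_exp, mul_assoc, ← Complex.exp_add]
    congr 2
    push_cast
    ring
  rw [← h3, h1, ← h2] at hpos
  have hC : 0 < ∫ v : ℝ, Real.exp (-(2 * (2 * a)) * v ^ 2) := by
    rw [integral_gaussian]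
    positivity
  rw [Complex.nonneg_iff, Complex.re_ofReal_mul, Complex.im_ofReal_mul, zero_eq_mul] at hpos
  exact Complex.nonneg_iff.2 ⟨(mul_nonneg_iff_of_pos_left hC).1 hpos.1,
    (hpos.2.resolve_left hC.ne').symm⟩

end PhaseDamping

end QuantumDamping

theorem theorem6 (Φ : QuantumDamping.QuantumChannel QuantumDamping.L2R) (lam : ℝ → ℂ)
    (hΦ : QuantumDamping.IsGeneralisedPhaseDamping Φ lam) :
    ∃ μ : Measure ℝ, IsProbabilityMeasure μ ∧
      (∀ x : ℝ, lam x = ∫ y : ℝ, Complex.exp (Complex.I * x * y) ∂μ) ∧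
      ∃ U : ℝ → unitary (QuantumDamping.L2R →L[ℂ] QuantumDamping.L2R),
        QuantumDamping.IsStronglyContinuousUnitaryGroup U ∧
        (∀ (t : ℝ) (ψ : QuantumDamping.L2R),
          (((U t : QuantumDamping.L2R →L[ℂ] QuantumDamping.L2R) ψ : QuantumDamping.L2R) : ℝ → ℂ)
            =ᵐ[volume] fun x => Complex.exp (Complex.I * t * x) * ψ x) ∧
        ∀ ρ : QuantumDamping.TraceClass QuantumDamping.L2R, QuantumDamping.IsState ρ →
          Integrable (fun t : ℝ => (U t : QuantumDamping.L2R →L[ℂ] QuantumDamping.L2R) ∘L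
            (ρ : QuantumDamping.L2R →L[ℂ] QuantumDamping.L2R) ∘L
            (star (U t) : QuantumDamping.L2R →L[ℂ] QuantumDamping.L2R)) μ ∧
          (Φ.toFun ρ : QuantumDamping.L2R →L[ℂ] QuantumDamping.L2R) =
            ∫ t : ℝ, (U t : QuantumDamping.L2R →L[ℂ] QuantumDamping.L2R) ∘L
              (ρ : QuantumDamping.L2R →L[ℂ] QuantumDamping.L2R) ∘L
              (star (U t) : QuantumDamping.L2R →L[ℂ] QuantumDamping.L2R) ∂μ := by
  have hpd := hΦ.isPositiveDefiniteFunction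
  have hc := hΦ.continuous
  obtain ⟨μ, hμ⟩ := QuantumDamping.exists_charFun_eq_of_gaussian_fourier_nonneg hc
    hpd.norm_le_one hpd.map_zero fun a ha w =>
      hΦ.dephasing.fourier_mul_gaussian_nonneg hc hpd.norm_le_one ha w
  have hlam : ∀ x : ℝ, lam x = ∫ y : ℝ, Complex.exp (Complex.I * x * y) ∂(μ : Measure ℝ) := by
    intro x
    rw [← hμ, charFun_apply_real]
    refine integral_congr_ae (Filter.Eventually.of_forall fun y => ?_)
    simp only
    congr 1
    ring
  refine ⟨μ, inferInstance, hlam, QuantumDamping.modulation,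
    QuantumDamping.isStronglyContinuousUnitaryGroup_modulation, QuantumDamping.modulation_ae,
    fun ρ hρ => ⟨QuantumDamping.integrable_unitaryOrbit
      QuantumDamping.continuous_modulation_apply μ ρ.2, ?_⟩⟩
  exact Φ.apply_state_eq_integral QuantumDamping.continuous_modulation_apply μ
    (hΦ.dephasing.apply_ketBra_eq_integral hc hpd.norm_le_one μ hlam) hρ
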